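/- Let $\mu>0$ and work with coordinates $(u,v,w)\in\mathbb C^3$, $O=(0,0,0)$, $W_0=\{w=0\}$, $U_0=\{u=0\}$, $I=\{u=0,\,w=0\}$. Consider the unknowns $$f\in\{\hat e^1_{01},\hat e^2_{01},\hat e^1_{11},\hat e^2_{11},\ \hat\Gamma_{0100},\hat\Gamma_{0101},\hat\Gamma_{0111},\hat\Gamma_{1100},\hat\Gamma_{1101},\hat\Gamma_{1111},\ \zeta,\zeta_0,\zeta_1,\zeta_2,\ \hat s\}$$ and $s_0,\dots,s_4$; write $s=\hat s-2$ and $\kappa=\mu/(1-\mu\zeta)$. For a holomorphic function $s_0^{*}(u,v)$ near $O$ in $W_0$, a *formal solution with datum $s_0^{*}$* is a choice of formal power series in $u,v,w$ for all the unknowns such that: (a) $s_0|_{w=0}$ is the Taylor series of $s_0^{*}$ at $O$; (b) the (singular) $\partial_u$-equations hold: $$\partial_u\hat e^1_{01}+\tfrac1u\hat e^1_{01}=-2\hat\Gamma_{0101}+2\hat\Gamma_{0100}\hat e^1_{01},\qquad \partial_u\hat e^2_{01}+\tfrac1u\hat e^2_{01}=\tfrac1u\hat\Gamma_{0100}+2\hat\Gamma_{0100}\hat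 e^2_{01},$$ $$\partial_u\hat e^1_{11}=-2\hat\Gamma_{1101}+2\hat\Gamma_{1100}\hat e^1_{01},\qquad \partial_u\hat e^2_{11}=\tfrac1u\hat\Gamma_{1100}+2\hat\Gamma_{1100}\hat e^2_{01},$$ $$\partial_u\hat\Gamma_{0100}+\tfrac2u\hat\Gamma_{0100}-2\hat\Gamma_{0100}^2=\tfrac12s_0,\qquad \partial_u\hat\Gamma_{0101}+\tfrac1u\hat\Gamma_{0101}-2\hat\Gamma_{0100}\hat\Gamma_{0101}=\tfrac12s_1,$$ $$\partial_u\hat\Gamma_{0111}+\tfrac1u\hat\Gamma_{0111}-2\hat\Gamma_{0100}\hat\Gamma_{0111}=\tfrac12s_2,\qquad \partial_u\hat\Gamma_{1100}+\tfrac1u\hat\Gamma_{1100}-2\hat\Gamma_{1100}\hat\Gamma_{0100}=s_1,$$ $$\partial_u\hat\Gamma_{1101}-2\hat\Gamma_{1100}\hat\Gamma_{0101}=s_2,\qquad \partial_u\hat\Gamma_{1111}-2\hat\Gamma_{1100}\hat\Gamma_{0111}=s_3,$$ $$\partial_u\zeta=\zeta_0,\quad \partial_u\zeta_0=-\zeta(1-\mu\zeta)s_0,\quad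 \partial_u\zeta_1=-\zeta(1-\mu\zeta)s_1,\quad \partial_u\zeta_2=s-\zeta(1-\mu\zeta)s_2,$$ $$\partial_us=-(1-\mu\zeta)(s_0\zeta_2-2s_1\zeta_1+s_2\zeta_0),$$ and, for $k=0,1,2,3$, $$\partial_us_{k+1}-\tfrac1{2u}\bigl(\partial_vs_k-(4-k)s_{k+1}\bigr)-\hat e^1_{01}\partial_us_k-\hat e^2_{01}\partial_vs_k=R_k,$$ $$R_0=-4\hat\Gamma_{0101}s_0+4\hat\Gamma_{0100}s_1-2\kappa(s_0\zeta_1-s_1\zeta_0),$$ $$R_1=-\hat\Gamma_{0111}s_0-2\hat\Gamma_{0101}s_1+3\hat\Gamma_{0100}s_2-\tfrac12\kappa(s_0\zeta_2+2s_1\zeta_1-3s_2\zeta_0),$$ $$R_2=-2\hat\Gamma_{0111}s_1+2\hat\Gamma_{0100}s_3-\kappa(s_1\zeta_2-s_3\zeta_0),$$ $$R_3=-3\hat\Gamma_{0111}s_2+2\hat\Gamma_{0101}s_3+\hat\Gamma_{0100}s_4-\tfrac12\kappa(3s_2\zeta_2-2s_3\zeta_1-s_4\zeta_0);$$ (c)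 the transport equation for $s_0$ holds: $$\partial_ws_0-\partial_us_2+\hat e^1_{11}\partial_us_0+\hat e^2_{11}\partial_vs_0=4\hat\Gamma_{1101}s_0-4\hat\Gamma_{1100}s_1+\kappa(s_0\zeta_2+2s_1\zeta_1-3s_2\zeta_0);$$ (d) on $U_0$ all $\hat e^a_{AB}$ and $\hat\Gamma_{ABCD}$ and $\zeta,\zeta_1,\zeta_2$ vanish, $\partial_w\zeta_0=s$, $\partial_ws=-s_4\zeta_0$ and $\partial_vs_k=(4-k)s_{k+1}$ for $k=0,1,2,3$; on $I$, $\zeta_0=0$ and $s=-2$. **Lemma.** Let $s_0^{*}$ be holomorphic on an open neighbourhood of $O$ in $W_0$, with an expansion near $O$ of the form $s_0^{*}(u,v)=\sum_{m=0}^\infty\sum_{n=0}^{2m+4}\psi_{m,n}u^mv^n$, and suppose that for some constants $c_0^*,r_0>0$ and $0<\rho_0<\tfrac12$ $$|\partial_u^m\partial_v^ns_0^{*}(O)|\le c_0^*\,\frac{m!\,n!\,r_0^m\rho_0^n}{(1+m)^2(1+n)^2},\qquad m\ge0,\ 0\le n\le2m+4.$$ Then there is exactly one formal solution with datum $s_0^{*}$,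 and there are constants $r\ge r_0$, $\rho>0$, $c_f>0$, $c_k>0$ such that its expansion coefficients satisfy, for all $m,n,p\ge0$, $$|\partial_u^m\partial_v^n\partial_w^ps_k(O)|\le c_k\,\frac{r^{m+p}(m+p)!\,\rho^nn!}{(m+1)^2(n+1)^2(p+1)^2}\quad(k=0,\dots,4),$$ $$|\partial_u^m\partial_v^n\partial_w^pf(O)|\le c_f\,\frac{r^{m+p-1}(m+p)!\,\rho^nn!}{(m+1)^2(n+1)^2(p+1)^2}$$ for every other unknown $f$ listed above. Hence the power series of all the unknowns converge absolutely for $|u|+|w|<1/r$, $|v|<1/\rho$. -/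

import Mathlib

open Filter Topology
open scoped Nat

noncomputable section

/-- Formal power series over `ℂ` in the three variables `u = X 0`, `v = X 1`, `w = X 2`. -/
abbrev FormalSeries : Type := MvPowerSeries (Fin 3) ℂ

namespace FormalSeries

/-- The coefficient of `u ^ m * v ^ n * w ^ p`. -/
def coeffAt (m n p : ℕ) (f : FormalSeries) : ℂ :=
  MvPowerSeries.coeff (Finsupp.single 0 m + Finsupp.single 1 n + Finsupp.single 2 p) f

/-- The expansion coefficient `∂_u ^ m ∂_v ^ n ∂_w ^ p f (O)` at `O = (0, 0, 0)`. -/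
def derivAt (m n p : ℕ) (f : FormalSeries) : ℂ :=
  (m ! : ℂ) * (n ! : ℂ) * (p ! : ℂ) * coeffAt m n p f

/-- The variable `u`. -/
def u : FormalSeries := MvPowerSeries.X 0

/-- Formal `∂_u`. -/
def du (f : FormalSeries) : FormalSeries := MvPowerSeries.pderiv ℂ 0 f

/-- Formal `∂_v`. -/
def dv (f : FormalSeries) : FormalSeries := MvPowerSeries.pderiv ℂ 1 f

/-- Formal `∂_w`. -/
def dw (f : FormalSeries) : FormalSeries := MvPowerSeries.pderiv ℂ 2 f

/-- `f = g` on `U₀ = {u = 0}`. -/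
def EqOnU₀ (f g : FormalSeries) : Prop :=
  ∀ n p : ℕ, coeffAt 0 n p f = coeffAt 0 n p g

/-- `f = g` on `I = {u = 0, w = 0}`. -/
def EqOnI (f g : FormalSeries) : Prop :=
  ∀ n : ℕ, coeffAt 0 n 0 f = coeffAt 0 n 0 g

/-- The power series `f` converges absolutely at the point `(u, v, w)`. -/
def AbsConvergesAt (f : FormalSeries) (u v w : ℂ) : Prop :=
  Summable fun i : ℕ × ℕ × ℕ =>
    ‖coeffAt i.1 i.2.1 i.2.2 f * u ^ i.1 * v ^ i.2.1 * w ^ i.2.2‖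

end FormalSeries

/-- The Taylor coefficient `∂_u ^ m ∂_v ^ n g (0, 0)` of a function of `(u, v)` that is holomorphic
near the origin (so that the order of the partial derivatives is immaterial). -/
def taylorDeriv (m n : ℕ) (g : ℂ × ℂ → ℂ) : ℂ :=
  iteratedDeriv n (fun v : ℂ => iteratedDeriv m (fun u : ℂ => g (u, v)) 0) 0

/-- Labels of the unknowns other than the curvature components `s_k`.
`eA_BC` is the regular part of the frame coefficient `e^A_{BC}`, `ΓABCD` the regular part of the
connection coefficient, `ζi` (for `i = 0, 1, 2`) is `ζ_{00}, ζ_{01}, ζ_{11}`, and `sHat` is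
`ŝ = 2 + s`. -/
inductive GaugeField : Type
  | e1_01 | e2_01 | e1_11 | e2_11
  | Γ0100 | Γ0101 | Γ0111 | Γ1100 | Γ1101 | Γ1111
  | ζ | ζ0 | ζ1 | ζ2
  | sHat

/-- A choice of formal power series for all the unknowns. -/
structure FormalFields : Type where
  f : GaugeField → FormalSeries
  s : Fin 5 → FormalSeries

namespace FormalFields

open FormalSeries GaugeField

/-- `s = ŝ - 2`. -/
def sScalar (F : FormalFields) : FormalSeries := F.f sHat - 2

/-- `1 - μ ζ`. -/
def factor (μ : ℝ) (F : FormalFields) : FormalSeries := 1 - (μ : ℂ) • F.f ζ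

/-- `μ / (1 - μ ζ)`. Here `1 - μ ζ` has constant coefficient `1`, hence is invertible,
whenever `ζ` vanishes at the origin. -/
def κ (μ : ℝ) (F : FormalFields) : FormalSeries := (μ : ℂ) • (F.factor μ)⁻¹

/-- The `∂_u`-equations. Those that contain the factor `1 / u` are written after multiplication
by `u`. -/
structure DuEquations (μ : ℝ) (F : FormalFields) : Prop where
  -- structural equations of the first kind, `t_{AB}^{EF}_{00} e^a_{EF} = 0`
  eq_e1_01 : u * du (F.f e1_01) + F.f e1_01
      = u * (-2 * F.f Γ0101 + 2 * F.f Γ0100 * F.f e1_01)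
  eq_e2_01 : u * du (F.f e2_01) + F.f e2_01
      = F.f Γ0100 + u * (2 * F.f Γ0100 * F.f e2_01)
  eq_e1_11 : du (F.f e1_11) = -2 * F.f Γ1101 + 2 * F.f Γ1100 * F.f e1_01
  eq_e2_11 : u * du (F.f e2_11) = F.f Γ1100 + u * (2 * F.f Γ1100 * F.f e2_01)
  -- structural equations of the second kind, `R_{AB00EF} = 0`
  eq_Γ0100 : u * du (F.f Γ0100) + 2 * F.f Γ0100 - u * (2 * F.f Γ0100 ^ 2)
      = u * ((1 / 2 : ℂ) • F.s 0)
  eq_Γ0101 : u * du (F.f Γ0101) + F.f Γ0101 - u * (2 * F.f Γ0100 * F.f Γ0101)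
      = u * ((1 / 2 : ℂ) • F.s 1)
  eq_Γ0111 : u * du (F.f Γ0111) + F.f Γ0111 - u * (2 * F.f Γ0100 * F.f Γ0111)
      = u * ((1 / 2 : ℂ) • F.s 2)
  eq_Γ1100 : u * du (F.f Γ1100) + F.f Γ1100 - u * (2 * F.f Γ1100 * F.f Γ0100) = u * F.s 1
  eq_Γ1101 : du (F.f Γ1101) - 2 * F.f Γ1100 * F.f Γ0101 = F.s 2
  eq_Γ1111 : du (F.f Γ1111) - 2 * F.f Γ1100 * F.f Γ0111 = F.s 3
  -- `Σ_{00} = 0`, `Σ_{00CD} = 0`, `S_{00} = 0`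
  eq_ζ : du (F.f ζ) - F.f ζ0 = 0
  eq_ζ0 : du (F.f ζ0) + F.f ζ * F.factor μ * F.s 0 = 0
  eq_ζ1 : du (F.f ζ1) + F.f ζ * F.factor μ * F.s 1 = 0
  eq_ζ2 : du (F.f ζ2) - F.sScalar + F.f ζ * F.factor μ * F.s 2 = 0
  eq_sScalar : du F.sScalar
      + F.factor μ * (F.s 0 * F.f ζ2 - 2 * F.s 1 * F.f ζ1 + F.s 2 * F.f ζ0) = 0
  -- `-H_{0(BCD)_k} = 0` for `k = 0, 1, 2, 3`
  eq_s1 : u * du (F.s 1) - (1 / 2 : ℂ) • (dv (F.s 0) - 4 * F.s 1)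
        - u * (F.f e1_01 * du (F.s 0) + F.f e2_01 * dv (F.s 0))
      = u * (-4 * F.f Γ0101 * F.s 0 + 4 * F.f Γ0100 * F.s 1
          - 2 * F.κ μ * (F.s 0 * F.f ζ1 - F.s 1 * F.f ζ0))
  eq_s2 : u * du (F.s 2) - (1 / 2 : ℂ) • (dv (F.s 1) - 3 * F.s 2)
        - u * (F.f e1_01 * du (F.s 1) + F.f e2_01 * dv (F.s 1))
      = u * (-F.f Γ0111 * F.s 0 - 2 * F.f Γ0101 * F.s 1 + 3 * F.f Γ0100 * F.s 2
          - (1 / 2 : ℂ) • (F.κ μ * (F.s 0 * F.f ζ2 + 2 * F.s 1 * F.f ζ1 - 3 * F.s 2 * F.f ζ0)))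
  eq_s3 : u * du (F.s 3) - (1 / 2 : ℂ) • (dv (F.s 2) - 2 * F.s 3)
        - u * (F.f e1_01 * du (F.s 2) + F.f e2_01 * dv (F.s 2))
      = u * (-2 * F.f Γ0111 * F.s 1 + 2 * F.f Γ0100 * F.s 3
          - F.κ μ * (F.s 1 * F.f ζ2 - F.s 3 * F.f ζ0))
  eq_s4 : u * du (F.s 4) - (1 / 2 : ℂ) • (dv (F.s 3) - F.s 4)
        - u * (F.f e1_01 * du (F.s 3) + F.f e2_01 * dv (F.s 3))
      = u * (-3 * F.f Γ0111 * F.s 2 + 2 * F.f Γ0101 * F.s 3 + F.f Γ0100 * F.s 4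
          - (1 / 2 : ℂ) • (F.κ μ * (3 * F.s 2 * F.f ζ2 - 2 * F.s 3 * F.f ζ1 - F.s 4 * F.f ζ0)))

/-- The transport equation `H_{0100} + H_{1000} = 0` for `s_0`. -/
def TransportEquation (μ : ℝ) (F : FormalFields) : Prop :=
  dw (F.s 0) - du (F.s 2) + F.f e1_11 * du (F.s 0) + F.f e2_11 * dv (F.s 0)
    = 4 * F.f Γ1101 * F.s 0 - 4 * F.f Γ1100 * F.s 1
      + F.κ μ * (F.s 0 * F.f ζ2 + 2 * F.s 1 * F.f ζ1 - 3 * F.s 2 * F.f ζ0)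

/-- The conditions on `U₀ = {u = 0}` and on `I = {u = 0, w = 0}` that fix the initial values of the
`∂_u`-equations. -/
structure InitialConditions (F : FormalFields) : Prop where
  ic_e1_01 : EqOnU₀ (F.f e1_01) 0
  ic_e2_01 : EqOnU₀ (F.f e2_01) 0
  ic_e1_11 : EqOnU₀ (F.f e1_11) 0
  ic_e2_11 : EqOnU₀ (F.f e2_11) 0
  ic_Γ0100 : EqOnU₀ (F.f Γ0100) 0
  ic_Γ0101 : EqOnU₀ (F.f Γ0101) 0
  ic_Γ0111 : EqOnU₀ (F.f Γ0111) 0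
  ic_Γ1100 : EqOnU₀ (F.f Γ1100) 0
  ic_Γ1101 : EqOnU₀ (F.f Γ1101) 0
  ic_Γ1111 : EqOnU₀ (F.f Γ1111) 0
  ic_ζ : EqOnU₀ (F.f ζ) 0
  ic_ζ1 : EqOnU₀ (F.f ζ1) 0
  ic_ζ2 : EqOnU₀ (F.f ζ2) 0
  ic_ζ0_I : EqOnI (F.f ζ0) 0
  ic_s_I : EqOnI F.sScalar (-2)
  ic_dw_ζ0 : EqOnU₀ (dw (F.f ζ0)) F.sScalar
  ic_dw_s : EqOnU₀ (dw F.sScalar) (-(F.s 4 * F.f ζ0))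
  -- `∂_v s_k = (4 - k) s_{k+1}` on `U₀` for `k = 0, 1, 2, 3`
  ic_dv_s : ∀ k : Fin 4, EqOnU₀ (dv (F.s k.castSucc)) ((4 - ((k : ℕ) : ℂ)) • F.s k.succ)

/-- `F` is the formal expansion determined by the datum `s₀ = s₀(u, v)` on `W₀ = {w = 0}`. -/
structure IsFormalSolution (μ : ℝ) (s₀ : ℂ × ℂ → ℂ) (F : FormalFields) : Prop where
  datum : ∀ m n : ℕ, derivAt m n 0 (F.s 0) = taylorDeriv m n s₀
  duEquations : F.DuEquations μ
  transport : F.TransportEquation μ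
  initial : F.InitialConditions

end FormalFields

end

/-!
Every equation of the problem can be solved for a derivative in `u` (for the transport equation, in
`w`) and integrated, so that the formal solutions are the fixed points of an operator `step` on
families of formal series; the factor `1 / (1 - μ ζ)` is treated as one more unknown `q`, governed by
`∂_u q = μ q ^ 2 ζ_0`. The coefficients of `u ^ m * w ^ p` in the result of `step` depend only on
coefficients that precede them if `(p, m)` is ordered lexicographically and the unknowns with the
same `(p, m)` are determined in a suitable order (`coeffAt_step_congr`). Well-founded recursion
therefore gives exactly one fixed point (`exists_unique_step_eq`), hence exactly one formal solution
(`exists_unique_isFormalSolution`). For the same reason every coefficientwise bound that `step`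
preserves holds for the solution (`bound_of_step_eq`).

The preserved bounds combine two facts. First, the equations are compatible with a grading: in the
coefficient of `u ^ m`, each unknown is a polynomial in `v` of degree at most `2 m + d`, where the
integer `d` (`weight`) is additive under products. For the datum this is the assumption on its
expansion. Because of it, the derivative `∂_v s_k`, which occurs in the equation for `s_{k+1}`
with the factor `1 / u` and without a compensating integration, loses nothing: `∂_v` gives at most
`2 m + d`, and solving the singular equation divides by `2 m + d` (`Maj.solveU_half_dv`).
Second, all series are compared with one series whose coefficients are
`(m + p).choose m * r ^ m * (16 r) ^ p / ((m + 1) ^ 2 * (n + 1) ^ 2 * (p + 1) ^ 2)` (`majorant`).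
Up to a constant it dominates its own square, by Vandermonde's identity, and the product of itself
with its `u`-derivative; each integration in `u` gains a factor `1 / r`. The transport equation
`∂_w s_0 = ∂_u s_2 + …` loses a `u`-derivative against a `w`-integration, and the larger rate in `w`
turns the bound `3 A` for `s_2` into a contribution `3 A / 4` to `s_0`. So the bounds `(k + 1) A` for
`s_k` and `c / r` for the fields are preserved when `c` is large in terms of `A`, and `r` in terms of
both (`exists_preserved_bounds`).

The majorant has the shape of the asserted estimates, with rate `16 r` in `u` and `w` and rate `1`
in `v`, and convergence follows from the binomial series in two variables.
-/

noncomputable section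

/-! ### Coefficients of formal series in three variables -/

namespace FormalSeries

open Finset

/-- The formal series with prescribed coefficients of `u ^ m * v ^ n * w ^ p`. -/
def ofCoeffs (c : ℕ → ℕ → ℕ → ℂ) : FormalSeries := fun i => c (i 0) (i 1) (i 2)

theorem exponent_eq (i : Fin 3 →₀ ℕ) :
    Finsupp.single 0 (i 0) + Finsupp.single 1 (i 1) + Finsupp.single 2 (i 2) = i := by
  ext j; fin_cases j <;> simp

@[simp]
theorem coeffAt_ofCoeffs (c : ℕ → ℕ → ℕ → ℂ) (m n p : ℕ) : coeffAt m n p (ofCoeffs c) = c m n p := by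
  change ofCoeffs c _ = _
  simp [ofCoeffs]

theorem coeff_eq_coeffAt (i : Fin 3 →₀ ℕ) (f : FormalSeries) :
    MvPowerSeries.coeff i f = coeffAt (i 0) (i 1) (i 2) f := by
  rw [coeffAt, exponent_eq]

theorem ext_coeffAt {f g : FormalSeries} (h : ∀ m n p, coeffAt m n p f = coeffAt m n p g) :
    f = g := by
  ext i
  rw [coeff_eq_coeffAt, coeff_eq_coeffAt, h]

@[simp]
theorem coeffAt_add (m n p : ℕ) (f g : FormalSeries) :
    coeffAt m n p (f + g) = coeffAt m n p f + coeffAt m n p g := by simp [coeffAt]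

@[simp]
theorem coeffAt_sub (m n p : ℕ) (f g : FormalSeries) :
    coeffAt m n p (f - g) = coeffAt m n p f - coeffAt m n p g := by simp [coeffAt]

@[simp]
theorem coeffAt_neg (m n p : ℕ) (f : FormalSeries) :
    coeffAt m n p (-f) = -coeffAt m n p f := by simp [coeffAt]

@[simp]
theorem coeffAt_smul (m n p : ℕ) (c : ℂ) (f : FormalSeries) :
    coeffAt m n p (c • f) = c * coeffAt m n p f := by simp [coeffAt]

@[simp]
theorem coeffAt_zero (m n p : ℕ) : coeffAt m n p 0 = 0 := by simp [coeffAt]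

theorem coeffAt_one (m n p : ℕ) :
    coeffAt m n p 1 = if m = 0 ∧ n = 0 ∧ p = 0 then 1 else 0 := by
  rw [coeffAt, MvPowerSeries.coeff_one]
  congr 1
  simp only [eq_iff_iff]
  constructor
  · intro h
    have h0 := DFunLike.congr_fun h 0
    have h1 := DFunLike.congr_fun h 1
    have h2 := DFunLike.congr_fun h 2
    simp at h0 h1 h2
    exact ⟨h0, h1, h2⟩
  · rintro ⟨rfl, rfl, rfl⟩; simp

theorem coeffAt_mul (m n p : ℕ) (f g : FormalSeries) :
    coeffAt m n p (f * g) = ∑ x ∈ antidiagonal m, ∑ y ∈ antidiagonal n, ∑ z ∈ antidiagonal p,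
      coeffAt x.1 y.1 z.1 f * coeffAt x.2 y.2 z.2 g := by
  classical
  rw [coeffAt, MvPowerSeries.coeff_mul]
  simp only [← Finset.sum_product']
  refine Finset.sum_bij' (fun a _ => ((a.1 0, a.2 0), ((a.1 1, a.2 1), (a.1 2, a.2 2))))
    (fun b _ => (Finsupp.single 0 b.1.1 + Finsupp.single 1 b.2.1.1 + Finsupp.single 2 b.2.2.1,
      Finsupp.single 0 b.1.2 + Finsupp.single 1 b.2.1.2 + Finsupp.single 2 b.2.2.2)) ?_ ?_ ?_ ?_ ?_
  · rintro ⟨a, b⟩ h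
    have h := HasAntidiagonal.mem_antidiagonal.1 h
    have h0 := DFunLike.congr_fun h 0
    have h1 := DFunLike.congr_fun h 1
    have h2 := DFunLike.congr_fun h 2
    simp at h0 h1 h2
    simp [h0, h1, h2]
  · rintro ⟨⟨a, b⟩, ⟨c, d⟩, e, f⟩ h
    simp only [mem_product, HasAntidiagonal.mem_antidiagonal] at h
    obtain ⟨rfl, rfl, rfl⟩ := h
    simp only [HasAntidiagonal.mem_antidiagonal, Finsupp.single_add]
    abel
  · rintro ⟨a, b⟩ h
    simp only [exponent_eq]
  · rintro ⟨⟨a, b⟩, ⟨c, d⟩, e, f⟩ h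
    simp
  · rintro ⟨a, b⟩ h
    simp only [coeff_eq_coeffAt]

@[simp]
theorem coeffAt_du (m n p : ℕ) (f : FormalSeries) :
    coeffAt m n p (du f) = (m + 1) * coeffAt (m + 1) n p f := by
  rw [coeffAt, du, MvPowerSeries.coeff_pderiv, coeff_eq_coeffAt, mul_comm]
  simp

@[simp]
theorem coeffAt_dv (m n p : ℕ) (f : FormalSeries) :
    coeffAt m n p (dv f) = (n + 1) * coeffAt m (n + 1) p f := by
  rw [coeffAt, dv, MvPowerSeries.coeff_pderiv, coeff_eq_coeffAt, mul_comm]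
  simp

@[simp]
theorem coeffAt_dw (m n p : ℕ) (f : FormalSeries) :
    coeffAt m n p (dw f) = (p + 1) * coeffAt m n (p + 1) f := by
  rw [coeffAt, dw, MvPowerSeries.coeff_pderiv, coeff_eq_coeffAt, mul_comm]
  simp

@[simp]
theorem coeffAt_zero_u_mul (n p : ℕ) (f : FormalSeries) : coeffAt 0 n p (u * f) = 0 := by
  rw [coeffAt, u, MvPowerSeries.X_def, MvPowerSeries.coeff_monomial_mul, if_neg]
  intro h
  simpa using h 0

@[simp]
theorem coeffAt_succ_u_mul (m n p : ℕ) (f : FormalSeries) :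
    coeffAt (m + 1) n p (u * f) = coeffAt m n p f := by
  have : (Finsupp.single 0 (m + 1) + Finsupp.single 1 n + Finsupp.single 2 p : Fin 3 →₀ ℕ) =
      Finsupp.single 0 1 + (Finsupp.single 0 m + Finsupp.single 1 n + Finsupp.single 2 p) := by
    rw [Finsupp.single_add]; abel
  rw [coeffAt, u, this, MvPowerSeries.X_def, MvPowerSeries.coeff_add_monomial_mul, one_mul, coeffAt]

/-! ### Solution operators for the singular ordinary differential equations -/

/-- The solution operator of `u ∂_u f + a f = h`: division of the coefficient of `u ^ m` by
`m + a`. For `a = 0` the coefficient of `u ^ 0` of the result is `0`, since `x / 0 = 0`. -/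
def solveU (a : ℝ) (h : FormalSeries) : FormalSeries :=
  ofCoeffs fun m n p => coeffAt m n p h / ((m + a : ℝ) : ℂ)

/-- The antiderivative in `w` that vanishes on `{w = 0}`. -/
def integrateW (g : FormalSeries) : FormalSeries :=
  ofCoeffs fun m n p => coeffAt m n (p - 1) g / (p : ℂ)

/-- The restriction to `{u = 0}`, as a series that does not depend on `u`. -/
def restrictU₀ (g : FormalSeries) : FormalSeries :=
  ofCoeffs fun m n p => if m = 0 then coeffAt m n p g else 0

@[simp]
theorem coeffAt_solveU (a : ℝ) (h : FormalSeries) (m n p : ℕ) :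
    coeffAt m n p (solveU a h) = coeffAt m n p h / ((m + a : ℝ) : ℂ) := coeffAt_ofCoeffs _ _ _ _

@[simp]
theorem coeffAt_integrateW (g : FormalSeries) (m n p : ℕ) :
    coeffAt m n p (integrateW g) = coeffAt m n (p - 1) g / (p : ℂ) := coeffAt_ofCoeffs _ _ _ _

@[simp]
theorem coeffAt_restrictU₀ (g : FormalSeries) (m n p : ℕ) :
    coeffAt m n p (restrictU₀ g) = if m = 0 then coeffAt m n p g else 0 := coeffAt_ofCoeffs _ _ _ _

theorem coeffAt_u_mul_du (m n p : ℕ) (f : FormalSeries) :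
    coeffAt m n p (u * du f) = m * coeffAt m n p f := by
  cases m <;> simp

theorem eq_solveU_iff {a : ℝ} (ha : 0 < a) (f h : FormalSeries) :
    f = solveU a h ↔ u * du f + (a : ℂ) • f = h := by
  have key : ∀ m : ℕ, ((m + a : ℝ) : ℂ) ≠ 0 := fun m => by
    exact_mod_cast (by positivity : (m + a : ℝ) ≠ 0)
  constructor
  · rintro rfl
    refine ext_coeffAt fun m n p => ?_
    have := key m
    simp only [coeffAt_add, coeffAt_u_mul_du, coeffAt_smul, coeffAt_solveU]
    field_simp
    push_cast; ring
  · rintro rfl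
    refine ext_coeffAt fun m n p => ?_
    have := key m
    simp only [coeffAt_add, coeffAt_u_mul_du, coeffAt_smul, coeffAt_solveU]
    field_simp
    push_cast; ring

theorem eq_solveU_zero_iff (f h : FormalSeries) (hh : EqOnU₀ h 0) :
    f = solveU 0 h ↔ u * du f = h ∧ EqOnU₀ f 0 := by
  constructor
  · rintro rfl
    refine ⟨ext_coeffAt fun m n p => ?_, fun n p => by simp⟩
    rw [coeffAt_u_mul_du, coeffAt_solveU]
    rcases m with _ | m
    · simpa using (hh n p).symm
    · have : ((m : ℂ) + 1) ≠ 0 := by exact_mod_cast m.succ_ne_zero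
      push_cast
      simp
      field_simp
  · rintro ⟨rfl, h0⟩
    refine ext_coeffAt fun m n p => ?_
    rw [coeffAt_solveU, coeffAt_u_mul_du]
    rcases m with _ | m
    · simpa using h0 n p
    · have : ((m : ℂ) + 1) ≠ 0 := by exact_mod_cast m.succ_ne_zero
      push_cast
      simp
      field_simp

theorem u_mul_injective {f g : FormalSeries} (h : u * f = u * g) : f = g :=
  ext_coeffAt fun m n p => by
    rw [← coeffAt_succ_u_mul, h, coeffAt_succ_u_mul]

theorem eqOnU₀_u_mul (g : FormalSeries) : EqOnU₀ (u * g) 0 := fun n p => by simp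

theorem eq_solveU_zero_u_mul_iff (f g : FormalSeries) :
    f = solveU 0 (u * g) ↔ du f = g ∧ EqOnU₀ f 0 := by
  rw [eq_solveU_zero_iff _ _ (eqOnU₀_u_mul g)]
  exact and_congr_left fun _ => ⟨u_mul_injective, fun h => by rw [h]⟩

/-- The equation `∂_u f = g` with initial values on `{u = 0}` that solve `∂_w f = h` there and vanish
for `w = 0`. -/
theorem eq_solveU_add_integrateW_iff (f g h : FormalSeries) :
    f = solveU 0 (u * g) + integrateW (restrictU₀ h) ↔
      du f = g ∧ EqOnU₀ (dw f) h ∧ EqOnI f 0 := by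
  constructor
  · rintro rfl
    refine ⟨ext_coeffAt fun m n p => ?_, fun n p => ?_, fun n => ?_⟩
    · have : ((m : ℂ) + 1) ≠ 0 := by exact_mod_cast m.succ_ne_zero
      simp
      field_simp
    · have : ((p : ℂ) + 1) ≠ 0 := by exact_mod_cast p.succ_ne_zero
      simp
      field_simp
    · simp
  · rintro ⟨rfl, h1, h2⟩
    refine ext_coeffAt fun m n p => ?_
    rcases m with _ | m
    · rcases p with _ | p
      · simpa using h2 n
      · have : ((p : ℂ) + 1) ≠ 0 := by exact_mod_cast p.succ_ne_zero
        have := h1 n p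
        simp at this
        simp [← this]
        field_simp
    · have : ((m : ℂ) + 1) ≠ 0 := by exact_mod_cast m.succ_ne_zero
      simp
      field_simp

theorem eq_add_integrateW_iff (f D g : FormalSeries) (hD : ∀ m n p, coeffAt m n (p + 1) D = 0) :
    f = D + integrateW g ↔ dw f = g ∧ ∀ m n, coeffAt m n 0 f = coeffAt m n 0 D := by
  constructor
  · rintro rfl
    refine ⟨ext_coeffAt fun m n p => ?_, fun m n => by simp⟩
    have : ((p : ℂ) + 1) ≠ 0 := by exact_mod_cast p.succ_ne_zero
    simp [hD]
    field_simp
  · rintro ⟨rfl, h⟩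
    refine ext_coeffAt fun m n p => ?_
    rcases p with _ | p
    · simp [h]
    · have : ((p : ℂ) + 1) ≠ 0 := by exact_mod_cast p.succ_ne_zero
      simp [hD]
      field_simp

end FormalSeries

/-! ### The majorant -/

namespace FormalSeries

open Finset

/-- The weight `1 / (n + 1) ^ 2`, whose convolution square is bounded by a multiple of itself. -/
def wgt (n : ℕ) : ℝ := 1 / ((n : ℝ) + 1) ^ 2

theorem wgt_pos (n : ℕ) : 0 < wgt n := by unfold wgt; positivity

theorem wgt_zero : wgt 0 = 1 := by simp [wgt]

theorem wgt_succ_le (n : ℕ) : wgt (n + 1) ≤ wgt n := by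
  unfold wgt
  push_cast
  gcongr
  linarith

theorem wgt_le_four_mul_succ (n : ℕ) : wgt n ≤ 4 * wgt (n + 1) := by
  unfold wgt
  rw [mul_one_div, div_le_div_iff₀ (by positivity) (by positivity)]
  push_cast
  nlinarith [(Nat.cast_nonneg n : (0 : ℝ) ≤ n)]

theorem sum_wgt_le (n : ℕ) : ∑ i ∈ range (n + 1), wgt i ≤ 2 - 1 / ((n : ℝ) + 1) := by
  induction n with
  | zero => norm_num [wgt]
  | succ n ih =>
    rw [sum_range_succ]
    have : wgt (n + 1) ≤ 1 / ((n : ℝ) + 1) - 1 / ((n : ℝ) + 1 + 1) := by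
      unfold wgt
      push_cast
      rw [div_sub_div _ _ (by positivity) (by positivity),
        div_le_div_iff₀ (by positivity) (by positivity)]
      nlinarith [(Nat.cast_nonneg n : (0 : ℝ) ≤ n)]
    push_cast
    linarith

/-- The reason is `(n + 2) / ((i + 1) (j + 1)) = 1 / (i + 1) + 1 / (j + 1)` for `i + j = n`. -/
theorem sum_wgt_mul_wgt_le (n : ℕ) : ∑ x ∈ antidiagonal n, wgt x.1 * wgt x.2 ≤ 8 * wgt n := by
  have h1 : ∀ x ∈ antidiagonal n, wgt x.1 * wgt x.2 ≤ 2 * wgt n * (wgt x.1 + wgt x.2) := by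
    rintro ⟨i, j⟩ h
    obtain rfl : i + j = n := HasAntidiagonal.mem_antidiagonal.1 h
    unfold wgt
    have hi : (0 : ℝ) ≤ i := Nat.cast_nonneg i
    have hj : (0 : ℝ) ≤ j := Nat.cast_nonneg j
    push_cast
    rw [div_mul_div_comm, div_add_div _ _ (by positivity) (by positivity), mul_one_div,
      div_mul_div_comm, div_le_div_iff₀ (by positivity) (by positivity)]
    have h2 : ((i : ℝ) + j + 1) ^ 2 ≤ 2 * (((i : ℝ) + 1) ^ 2 + ((j : ℝ) + 1) ^ 2) := by
      nlinarith [sq_nonneg ((i : ℝ) - j)]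
    have h3 : 0 ≤ ((i : ℝ) + 1) ^ 2 * ((j : ℝ) + 1) ^ 2 := by positivity
    nlinarith [mul_le_mul_of_nonneg_right h2 h3]
  have h2 : ∑ x ∈ antidiagonal n, wgt x.1 ≤ 2 := by
    rw [Nat.sum_antidiagonal_eq_sum_range_succ_mk]
    refine (sum_wgt_le n).trans ?_
    have : 0 ≤ 1 / ((n : ℝ) + 1) := by positivity
    linarith
  have h3 : ∑ x ∈ antidiagonal n, wgt x.2 ≤ 2 := by
    rw [← Nat.sum_antidiagonal_swap]
    exact h2
  calc ∑ x ∈ antidiagonal n, wgt x.1 * wgt x.2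
      ≤ ∑ x ∈ antidiagonal n, 2 * wgt n * (wgt x.1 + wgt x.2) := sum_le_sum h1
    _ = 2 * wgt n * (∑ x ∈ antidiagonal n, wgt x.1 + ∑ x ∈ antidiagonal n, wgt x.2) := by
        rw [← mul_sum, sum_add_distrib]
    _ ≤ 2 * wgt n * (2 + 2) := by
        have := wgt_pos n
        gcongr
    _ = 8 * wgt n := by ring

/-- The coefficients of the majorant series. The rate in `w` is `16` times the rate in `u`; this
makes `∂_u` small compared with `∂_w`. -/
def majorant (r : ℝ) (m n p : ℕ) : ℝ :=
  ((m + p).choose m : ℝ) * r ^ m * (16 * r) ^ p * (wgt m * wgt n * wgt p)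

theorem majorant_nonneg {r : ℝ} (hr : 0 < r) (m n p : ℕ) : 0 ≤ majorant r m n p := by
  have := wgt_pos m
  have := wgt_pos n
  have := wgt_pos p
  unfold majorant
  positivity

theorem majorant_zero (r : ℝ) : majorant r 0 0 0 = 1 := by simp [majorant, wgt_zero]

theorem majorant_le_succ_u {r : ℝ} (hr : 0 < r) (m n p : ℕ) :
    majorant r m n p ≤ 4 / r * majorant r (m + 1) n p := by
  have := wgt_pos m
  have := wgt_pos n
  have := wgt_pos p
  have h1 : (((m + p).choose m : ℕ) : ℝ) ≤ ((m + 1 + p).choose (m + 1) : ℕ) := by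
    rw [show m + 1 + p = (m + p) + 1 by ring, Nat.choose_succ_succ]
    exact_mod_cast Nat.le_add_right _ _
  unfold majorant
  calc ((m + p).choose m : ℝ) * r ^ m * (16 * r) ^ p * (wgt m * wgt n * wgt p)
      ≤ ((m + 1 + p).choose (m + 1) : ℝ) * r ^ m * (16 * r) ^ p *
          ((4 * wgt (m + 1)) * wgt n * wgt p) := by
        gcongr
        exact wgt_le_four_mul_succ m
    _ = _ := by field_simp; ring

theorem majorant_le_succ_w {r : ℝ} (hr : 0 < r) (m n p : ℕ) :
    majorant r m n p ≤ 4 / r * majorant r m n (p + 1) := by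
  have := wgt_pos m
  have := wgt_pos n
  have := wgt_pos p
  have := wgt_pos (p + 1)
  have h1 : (((m + p).choose m : ℕ) : ℝ) ≤ ((m + (p + 1)).choose m : ℕ) := by
    exact_mod_cast Nat.choose_le_choose _ (by omega)
  unfold majorant
  calc ((m + p).choose m : ℝ) * r ^ m * (16 * r) ^ p * (wgt m * wgt n * wgt p)
      ≤ ((m + (p + 1)).choose m : ℝ) * r ^ m * (16 * r) ^ p *
          (wgt m * wgt n * (4 * wgt (p + 1))) := by
        gcongr
        exact wgt_le_four_mul_succ p
    _ ≤ ((m + (p + 1)).choose m : ℝ) * r ^ m * (16 * r) ^ p *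
          (wgt m * wgt n * (4 * wgt (p + 1))) * 16 :=
        le_mul_of_one_le_right (by have := wgt_pos m; positivity) (by norm_num)
    _ = _ := by field_simp; ring

theorem majorant_succ_v_le {r : ℝ} (hr : 0 < r) (m n p : ℕ) :
    majorant r m (n + 1) p ≤ majorant r m n p := by
  have := wgt_pos m
  have := wgt_pos p
  unfold majorant
  gcongr
  exact wgt_succ_le n

/-- On the majorant, `∂_u` is at most a quarter of `∂_w`. -/
theorem du_majorant_le_dw_majorant {r : ℝ} (hr : 0 < r) (m n p : ℕ) :
    (m + 1) * majorant r (m + 1) n p ≤ 1 / 4 * ((p + 1) * majorant r m n (p + 1)) := by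
  have h0 := wgt_pos m
  have h1 := wgt_pos n
  have h2 := wgt_pos (p + 1)
  have h3 := wgt_pos p
  have hc : ((m : ℝ) + 1) * ((m + 1 + p).choose (m + 1) : ℕ) =
      ((p : ℝ) + 1) * ((m + (p + 1)).choose m : ℕ) := by
    have h := Nat.choose_succ_right_eq (m + 1 + p) m
    rw [show m + 1 + p - m = p + 1 by omega] at h
    rw [show m + (p + 1) = m + 1 + p by ring]
    have h' : (((m + 1 + p).choose (m + 1) * (m + 1) : ℕ) : ℝ) =
      ((m + 1 + p).choose m * (p + 1) : ℕ) := by rw [h]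
    push_cast at h'
    linarith
  unfold majorant
  calc ((m : ℝ) + 1) * (((m + 1 + p).choose (m + 1) : ℝ) * r ^ (m + 1) * (16 * r) ^ p *
        (wgt (m + 1) * wgt n * wgt p))
      = (((m : ℝ) + 1) * ((m + 1 + p).choose (m + 1) : ℝ)) * r ^ (m + 1) * (16 * r) ^ p *
        (wgt (m + 1) * wgt n * wgt p) := by ring
    _ ≤ (((m : ℝ) + 1) * ((m + 1 + p).choose (m + 1) : ℝ)) * r ^ (m + 1) * (16 * r) ^ p *
        (wgt m * wgt n * (4 * wgt (p + 1))) := by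
        have := wgt_le_four_mul_succ p
        have := wgt_succ_le m
        gcongr
    _ = _ := by rw [hc]; ring

/-- The binomial coefficients are estimated by one summand of Vandermonde's identity. -/
theorem majorant_mul_majorant_le {r : ℝ} (hr : 0 < r) (m₁ m₂ n₁ n₂ p₁ p₂ : ℕ) :
    majorant r m₁ n₁ p₁ * majorant r m₂ n₂ p₂ ≤
      ((m₁ + m₂ + (p₁ + p₂)).choose (m₁ + m₂) : ℝ) * r ^ (m₁ + m₂) * (16 * r) ^ (p₁ + p₂) *
        ((wgt m₁ * wgt m₂) * ((wgt n₁ * wgt n₂) * (wgt p₁ * wgt p₂))) := by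
  have hc : (((m₁ + p₁).choose m₁ * (m₂ + p₂).choose m₂ : ℕ) : ℝ) ≤
      ((m₁ + m₂ + (p₁ + p₂)).choose (m₁ + m₂) : ℕ) := by
    rw [show m₁ + m₂ + (p₁ + p₂) = (m₁ + p₁) + (m₂ + p₂) by ring,
      Nat.add_choose_eq (m₁ + p₁) (m₂ + p₂) (m₁ + m₂), Nat.cast_le]
    exact Finset.single_le_sum
      (f := fun ij : ℕ × ℕ => (m₁ + p₁).choose ij.1 * (m₂ + p₂).choose ij.2)
      (fun _ _ => Nat.zero_le _)
      (HasAntidiagonal.mem_antidiagonal.2 rfl : (m₁, m₂) ∈ antidiagonal (m₁ + m₂))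
  rw [Nat.cast_mul] at hc
  have hw : 0 ≤ (wgt m₁ * wgt m₂) * ((wgt n₁ * wgt n₂) * (wgt p₁ * wgt p₂)) := by
    have h1 := wgt_pos m₁
    have h2 := wgt_pos m₂
    have h3 := wgt_pos n₁
    have h4 := wgt_pos n₂
    have h5 := wgt_pos p₁
    have h6 := wgt_pos p₂
    positivity
  calc majorant r m₁ n₁ p₁ * majorant r m₂ n₂ p₂
      = (((m₁ + p₁).choose m₁ : ℝ) * ((m₂ + p₂).choose m₂ : ℝ)) * r ^ (m₁ + m₂) *
        (16 * r) ^ (p₁ + p₂) * ((wgt m₁ * wgt m₂) * ((wgt n₁ * wgt n₂) * (wgt p₁ * wgt p₂))) := by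
        unfold majorant
        rw [pow_add, pow_add]; ring
    _ ≤ _ := by
        refine mul_le_mul_of_nonneg_right ?_ hw
        gcongr

theorem sum_majorant_mul_majorant_le {r : ℝ} (hr : 0 < r) (m n p : ℕ) :
    ∑ x ∈ antidiagonal m, ∑ y ∈ antidiagonal n, ∑ z ∈ antidiagonal p,
      majorant r x.1 y.1 z.1 * majorant r x.2 y.2 z.2 ≤ 512 * majorant r m n p := by
  have key : ∀ x ∈ antidiagonal m, ∀ y ∈ antidiagonal n, ∀ z ∈ antidiagonal p,
      majorant r x.1 y.1 z.1 * majorant r x.2 y.2 z.2 ≤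
        ((m + p).choose m : ℝ) * r ^ m * (16 * r) ^ p *
          ((wgt x.1 * wgt x.2) * ((wgt y.1 * wgt y.2) * (wgt z.1 * wgt z.2))) := by
    intro x hx y _ z hz
    rw [← HasAntidiagonal.mem_antidiagonal.1 hx, ← HasAntidiagonal.mem_antidiagonal.1 hz]
    exact majorant_mul_majorant_le hr _ _ _ _ _ _
  have hS : ∀ k, 0 ≤ ∑ x ∈ antidiagonal k, wgt x.1 * wgt x.2 := fun k =>
    sum_nonneg fun x _ => (mul_pos (wgt_pos _) (wgt_pos _)).le
  have h8 : ∀ k, 0 ≤ 8 * wgt k := fun k => by have := wgt_pos k; positivity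
  calc _ ≤ ∑ x ∈ antidiagonal m, ∑ y ∈ antidiagonal n, ∑ z ∈ antidiagonal p,
        ((m + p).choose m : ℝ) * r ^ m * (16 * r) ^ p *
          ((wgt x.1 * wgt x.2) * ((wgt y.1 * wgt y.2) * (wgt z.1 * wgt z.2))) :=
        sum_le_sum fun x hx => sum_le_sum fun y hy => sum_le_sum fun z hz => key x hx y hy z hz
    _ = ((m + p).choose m : ℝ) * r ^ m * (16 * r) ^ p *
        ((∑ x ∈ antidiagonal m, wgt x.1 * wgt x.2) * ((∑ y ∈ antidiagonal n, wgt y.1 * wgt y.2) *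
          ∑ z ∈ antidiagonal p, wgt z.1 * wgt z.2)) := by
        simp only [← mul_sum, ← sum_mul]
    _ ≤ ((m + p).choose m : ℝ) * r ^ m * (16 * r) ^ p *
        ((8 * wgt m) * ((8 * wgt n) * (8 * wgt p))) := by
        refine mul_le_mul_of_nonneg_left ?_ (by positivity)
        exact mul_le_mul (sum_wgt_mul_wgt_le m)
          (mul_le_mul (sum_wgt_mul_wgt_le n) (sum_wgt_mul_wgt_le p) (hS p) (h8 n))
          (mul_nonneg (hS n) (hS p)) (h8 m)
    _ = _ := by unfold majorant; ring

/-! ### Majorized series -/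

/-- `f` is majorized by `C` times the majorant, and the coefficient of `u ^ m` has degree at most
`2 m + d` in `v`. -/
structure Maj (r : ℝ) (d : ℤ) (C : ℝ) (f : FormalSeries) : Prop where
  vanish : ∀ m n p : ℕ, 2 * (m : ℤ) + d < n → coeffAt m n p f = 0
  bound : ∀ m n p : ℕ, ‖coeffAt m n p f‖ ≤ C * majorant r m n p

/-- `f` is majorized by `C` times the `u`-derivative of the majorant, and the coefficient of `u ^ m`
has degree at most `2 m + d` in `v`. -/
structure MajDu (r : ℝ) (d : ℤ) (C : ℝ) (f : FormalSeries) : Prop where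
  vanish : ∀ m n p : ℕ, 2 * (m : ℤ) + d < n → coeffAt m n p f = 0
  bound : ∀ m n p : ℕ, ‖coeffAt m n p f‖ ≤ C * ((m + 1) * majorant r (m + 1) n p)

namespace Maj

variable {r C D : ℝ} {d e : ℤ} {f g : FormalSeries}

theorem nonneg (h : Maj r d C f) : 0 ≤ C := by
  simpa [majorant_zero] using (norm_nonneg _).trans (h.bound 0 0 0)

theorem mono (hr : 0 < r) (h : Maj r d C f) (hd : d ≤ e) (hC : C ≤ D) : Maj r e D f :=
  ⟨fun m n p hn => h.vanish m n p (by omega),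
    fun m n p => (h.bound m n p).trans (by have := majorant_nonneg hr m n p; gcongr)⟩

theorem zero (hr : 0 < r) (d : ℤ) (hC : 0 ≤ C) : Maj r d C 0 :=
  ⟨by simp, fun m n p => by simpa using mul_nonneg hC (majorant_nonneg hr m n p)⟩

theorem add (hf : Maj r d C f) (hg : Maj r e D g) :
    Maj r (max d e) (C + D) (f + g) :=
  ⟨fun m n p hn => by
      rw [coeffAt_add, hf.vanish m n p (by omega), hg.vanish m n p (by omega), add_zero],
    fun m n p => by
      rw [coeffAt_add, add_mul]
      exact (norm_add_le _ _).trans (add_le_add (hf.bound m n p) (hg.bound m n p))⟩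

theorem neg (hf : Maj r d C f) : Maj r d C (-f) :=
  ⟨fun m n p hn => by rw [coeffAt_neg, hf.vanish m n p hn, neg_zero],
    fun m n p => by rw [coeffAt_neg, norm_neg]; exact hf.bound m n p⟩

theorem smul (c : ℂ) (hf : Maj r d C f) : Maj r d (‖c‖ * C) (c • f) :=
  ⟨fun m n p hn => by rw [coeffAt_smul, hf.vanish m n p hn, mul_zero],
    fun m n p => by
      rw [coeffAt_smul, norm_mul, mul_assoc]
      exact mul_le_mul_of_nonneg_left (hf.bound m n p) (norm_nonneg _)⟩

theorem one (hr : 0 < r) : Maj r 0 1 1 :=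
  ⟨fun m n p hn => by
      rw [coeffAt_one, if_neg (by omega)],
    fun m n p => by
      rw [coeffAt_one]
      split_ifs with h
      · obtain ⟨rfl, rfl, rfl⟩ := h
        simp [majorant_zero]
      · simpa using majorant_nonneg hr m n p⟩

theorem ofNat (hr : 0 < r) (k : ℕ) [k.AtLeastTwo] :
    Maj r 0 k (OfNat.ofNat k : FormalSeries) := by
  have h := (one hr).smul (k : ℂ)
  have e : ((k : ℂ) • (1 : FormalSeries)) = (OfNat.ofNat k : FormalSeries) := by
    rw [Nat.cast_smul_eq_nsmul, nsmul_eq_mul, mul_one]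
    exact Nat.cast_ofNat (R := FormalSeries) (n := k)
  rw [e] at h
  simpa using h

theorem mul (hr : 0 < r) (hf : Maj r d C f) (hg : Maj r e D g) :
    Maj r (d + e) (512 * (C * D)) (f * g) := by
  refine ⟨fun m n p hn => ?_, fun m n p => ?_⟩
  · rw [coeffAt_mul]
    refine sum_eq_zero fun x hx => sum_eq_zero fun y hy => sum_eq_zero fun z _ => ?_
    have hx := HasAntidiagonal.mem_antidiagonal.1 hx
    have hy := HasAntidiagonal.mem_antidiagonal.1 hy
    rcases lt_or_ge (2 * (x.1 : ℤ) + d) y.1 with h | h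
    · rw [hf.vanish _ _ _ h, zero_mul]
    · rw [hg.vanish _ _ _ (by omega), mul_zero]
  · rw [coeffAt_mul]
    have hC := hf.nonneg
    calc _ ≤ ∑ x ∈ antidiagonal m, ∑ y ∈ antidiagonal n, ∑ z ∈ antidiagonal p,
          (C * D) * (majorant r x.1 y.1 z.1 * majorant r x.2 y.2 z.2) := by
          refine norm_sum_le_of_le _ fun x _ => norm_sum_le_of_le _ fun y _ =>
            norm_sum_le_of_le _ fun z _ => ?_
          rw [norm_mul, mul_mul_mul_comm]
          exact mul_le_mul (hf.bound _ _ _) (hg.bound _ _ _) (norm_nonneg _)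
            (mul_nonneg hC (majorant_nonneg hr _ _ _))
      _ = (C * D) * ∑ x ∈ antidiagonal m, ∑ y ∈ antidiagonal n, ∑ z ∈ antidiagonal p,
          majorant r x.1 y.1 z.1 * majorant r x.2 y.2 z.2 := by simp only [← mul_sum]
      _ ≤ (C * D) * (512 * majorant r m n p) :=
          mul_le_mul_of_nonneg_left (sum_majorant_mul_majorant_le hr m n p)
            (mul_nonneg hC hg.nonneg)
      _ = _ := by ring

/-- Multiplication by a majorized series preserves majorization by the derivative: the factor
`k + 1` from the derivative is at most `m + 1` in the coefficient of `u ^ m` of the product. -/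
theorem mul_majDu (hr : 0 < r) (hf : Maj r d C f) (hg : MajDu r e D g) (hD : 0 ≤ D) :
    MajDu r (d + e) (512 * (C * D)) (f * g) := by
  refine ⟨fun m n p hn => ?_, fun m n p => ?_⟩
  · rw [coeffAt_mul]
    refine sum_eq_zero fun x hx => sum_eq_zero fun y hy => sum_eq_zero fun z _ => ?_
    have hx := HasAntidiagonal.mem_antidiagonal.1 hx
    have hy := HasAntidiagonal.mem_antidiagonal.1 hy
    rcases lt_or_ge (2 * (x.1 : ℤ) + d) y.1 with h | h
    · rw [hf.vanish _ _ _ h, zero_mul]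
    · rw [hg.vanish _ _ _ (by omega), mul_zero]
  · rw [coeffAt_mul]
    have hC := hf.nonneg
    have hM := fun a b c => majorant_nonneg hr a b c
    calc _ ≤ ∑ x ∈ antidiagonal m, ∑ y ∈ antidiagonal n, ∑ z ∈ antidiagonal p,
          (C * D * (m + 1)) * (majorant r x.1 y.1 z.1 * majorant r (x.2 + 1) y.2 z.2) := by
          refine norm_sum_le_of_le _ fun x hx => norm_sum_le_of_le _ fun y _ =>
            norm_sum_le_of_le _ fun z _ => ?_
          have hx := HasAntidiagonal.mem_antidiagonal.1 hx
          have hx2 : (x.2 : ℝ) ≤ m := by exact_mod_cast (by omega : x.2 ≤ m)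
          have h1 := hM x.1 y.1 z.1
          have h2 := hM (x.2 + 1) y.2 z.2
          rw [norm_mul]
          calc _ ≤ (C * majorant r x.1 y.1 z.1) *
                (D * ((x.2 + 1) * majorant r (x.2 + 1) y.2 z.2)) :=
                mul_le_mul (hf.bound _ _ _) (hg.bound _ _ _) (norm_nonneg _)
                  (mul_nonneg hC h1)
            _ ≤ (C * majorant r x.1 y.1 z.1) *
                (D * ((m + 1) * majorant r (x.2 + 1) y.2 z.2)) := by gcongr
            _ = _ := by ring
      _ = (C * D * (m + 1)) * ∑ x ∈ antidiagonal m, ∑ y ∈ antidiagonal n, ∑ z ∈ antidiagonal p,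
          majorant r x.1 y.1 z.1 * majorant r (x.2 + 1) y.2 z.2 := by simp only [← mul_sum]
      _ ≤ (C * D * (m + 1)) * ∑ x ∈ antidiagonal (m + 1), ∑ y ∈ antidiagonal n,
          ∑ z ∈ antidiagonal p, majorant r x.1 y.1 z.1 * majorant r x.2 y.2 z.2 := by
          gcongr
          rw [Nat.sum_antidiagonal_succ']
          refine le_add_of_nonneg_left ?_
          exact sum_nonneg fun y _ => sum_nonneg fun z _ => mul_nonneg (hM _ _ _) (hM _ _ _)
      _ ≤ (C * D * (m + 1)) * (512 * majorant r (m + 1) n p) := by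
          gcongr
          exact sum_majorant_mul_majorant_le hr (m + 1) n p
      _ = _ := by ring

theorem majDu (hr : 0 < r) (hf : Maj r d C f) : MajDu r d (4 * C / r) f :=
  ⟨hf.vanish, fun m n p => by
    have hC := hf.nonneg
    have hM := majorant_nonneg hr (m + 1) n p
    calc _ ≤ C * majorant r m n p := hf.bound m n p
      _ ≤ C * (4 / r * (1 * majorant r (m + 1) n p)) := by
          rw [one_mul]
          gcongr
          exact majorant_le_succ_u hr m n p
      _ ≤ C * (4 / r * ((m + 1) * majorant r (m + 1) n p)) := by
          gcongr
          linarith [(Nat.cast_nonneg m : (0 : ℝ) ≤ m)]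
      _ = _ := by ring⟩

theorem du (hf : Maj r d C f) : MajDu r (d + 2) C (du f) :=
  ⟨fun m n p hn => by
      rw [coeffAt_du, hf.vanish (m + 1) n p (by push_cast; omega), mul_zero],
    fun m n p => by
      have h1 : ‖((m : ℂ) + 1)‖ = m + 1 := by
        rw [← Nat.cast_succ, Complex.norm_natCast, Nat.cast_succ]
      rw [coeffAt_du, norm_mul, h1, mul_left_comm]
      exact mul_le_mul_of_nonneg_left (hf.bound (m + 1) n p) (by positivity)⟩

/-- Here the bound on the degree in `v` enters: it makes `∂_v` at most as large as `∂_u`. -/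
theorem dv (hr : 1 ≤ r) (hf : Maj r d C f) (hd : d ≤ 4) : MajDu r (d - 1) (16 * C) (dv f) := by
  have hr0 : 0 < r := by linarith
  refine ⟨fun m n p hn => by
      rw [coeffAt_dv, hf.vanish m (n + 1) p (by push_cast; omega), mul_zero], fun m n p => ?_⟩
  have hC := hf.nonneg
  have hM := majorant_nonneg hr0 (m + 1) n p
  rw [coeffAt_dv]
  rcases lt_or_ge (2 * (m : ℤ) + d) ((n + 1 : ℕ) : ℤ) with h | h
  · rw [hf.vanish _ _ _ h, mul_zero, norm_zero]
    positivity
  · have h1 : ‖((n : ℂ) + 1)‖ = n + 1 := by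
      rw [← Nat.cast_succ, Complex.norm_natCast, Nat.cast_succ]
    have h2 : (n : ℝ) + 1 ≤ 4 * (m + 1) := by
      exact_mod_cast (by push_cast at h; omega : n + 1 ≤ 4 * (m + 1))
    rw [norm_mul, h1]
    calc ((n : ℝ) + 1) * ‖coeffAt m (n + 1) p f‖
        ≤ (4 * (m + 1)) * (C * majorant r m (n + 1) p) := by
          gcongr
          exact hf.bound _ _ _
      _ ≤ (4 * (m + 1)) * (C * (4 / 1 * majorant r (m + 1) n p)) := by
          gcongr
          refine (majorant_succ_v_le hr0 m n p).trans ((majorant_le_succ_u hr0 m n p).trans ?_)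
          gcongr
      _ = _ := by ring

theorem solveU (a : ℕ) (hf : Maj r d C f) : Maj r d C (solveU a f) := by
  refine ⟨fun m n p hn => by rw [coeffAt_solveU, hf.vanish m n p hn, zero_div], fun m n p => ?_⟩
  refine le_trans ?_ (hf.bound m n p)
  have h1 : ((m + (a : ℝ) : ℝ) : ℂ) = ((m + a : ℕ) : ℂ) := by push_cast; rfl
  rw [coeffAt_solveU, norm_div, h1, Complex.norm_natCast]
  rcases Nat.eq_zero_or_pos (m + a) with h | h
  · rw [h]; simp
  · exact div_le_self (norm_nonneg _) (by exact_mod_cast h)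

/-- Here the bound on the degree in `v` enters: in the coefficient of `u ^ m`, the factor `n + 1`
from `∂_v` is at most `2 m + d`, which the division by `m + d / 2` compensates. -/
theorem solveU_half_dv (hr : 0 < r) (hf : Maj r d C f) (hd : 0 < d) :
    Maj r (d - 1) C (FormalSeries.solveU (d / 2) ((1 / 2 : ℂ) • FormalSeries.dv f)) := by
  refine ⟨fun m n p hn => ?_, fun m n p => ?_⟩
  · rw [coeffAt_solveU, coeffAt_smul, coeffAt_dv, hf.vanish m (n + 1) p (by push_cast; omega)]
    simp
  · rw [coeffAt_solveU, coeffAt_smul, coeffAt_dv]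
    have hC := hf.nonneg
    rcases lt_or_ge (2 * (m : ℤ) + d) ((n + 1 : ℕ) : ℤ) with h | h
    · rw [hf.vanish _ _ _ h]
      simpa using mul_nonneg hC (majorant_nonneg hr m n p)
    · have hd' : (0 : ℝ) < d := by exact_mod_cast hd
      have h1 : ‖((n : ℂ) + 1)‖ = n + 1 := by
        rw [← Nat.cast_succ, Complex.norm_natCast, Nat.cast_succ]
      have h2 : (n : ℝ) + 1 ≤ 2 * m + d := by exact_mod_cast h
      have h3 : ‖((m + d / 2 : ℝ) : ℂ)‖ = m + d / 2 := by
        rw [Complex.norm_real, Real.norm_of_nonneg (by positivity)]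
      rw [norm_div, norm_mul, norm_mul, h1, h3, div_le_iff₀ (by positivity)]
      have h4 : ‖(1 / 2 : ℂ)‖ = 1 / 2 := by simp
      rw [h4]
      calc 1 / 2 * (((n : ℝ) + 1) * ‖coeffAt m (n + 1) p f‖)
          ≤ 1 / 2 * ((2 * m + d) * (C * majorant r m n p)) := by
            gcongr
            exact (hf.bound _ _ _).trans
              (mul_le_mul_of_nonneg_left (majorant_succ_v_le hr m n p) hC)
        _ = _ := by ring

theorem integrateW_restrictU₀ (hr : 0 < r) (hf : Maj r d C f) :
    Maj r d (4 * C / r) (integrateW (restrictU₀ f)) := by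
  have hC := hf.nonneg
  refine ⟨fun m n p hn => ?_, fun m n p => ?_⟩
  · rw [coeffAt_integrateW, coeffAt_restrictU₀, hf.vanish _ _ _ hn]
    simp
  · rw [coeffAt_integrateW, coeffAt_restrictU₀]
    have hM := majorant_nonneg hr m n p
    rcases p with _ | p
    · simp
      positivity
    · have h1 : ‖((p + 1 : ℕ) : ℂ)‖ = p + 1 := by rw [Complex.norm_natCast, Nat.cast_succ]
      split_ifs with h
      · rw [norm_div, h1]
        refine (div_le_self (norm_nonneg _) (by linarith [(Nat.cast_nonneg p : (0 : ℝ) ≤ p)])).trans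
          ((hf.bound _ _ _).trans ?_)
        calc C * majorant r m n (p + 1 - 1) ≤ C * (4 / r * majorant r m n (p + 1)) := by
              gcongr
              exact majorant_le_succ_w hr m n p
          _ = _ := by ring
      · rw [zero_div, norm_zero]
        positivity

end Maj

namespace MajDu

variable {r C D : ℝ} {d e : ℤ} {f g : FormalSeries}

theorem mono (hr : 0 < r) (h : MajDu r d C f) (hd : d ≤ e) (hC : C ≤ D) : MajDu r e D f :=
  ⟨fun m n p hn => h.vanish m n p (by omega),
    fun m n p => (h.bound m n p).trans
      (by have := majorant_nonneg hr (m + 1) n p; gcongr)⟩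

theorem add (hf : MajDu r d C f) (hg : MajDu r e D g) : MajDu r (max d e) (C + D) (f + g) :=
  ⟨fun m n p hn => by
      rw [coeffAt_add, hf.vanish m n p (by omega), hg.vanish m n p (by omega), add_zero],
    fun m n p => by
      rw [coeffAt_add, add_mul]
      exact (norm_add_le _ _).trans (add_le_add (hf.bound m n p) (hg.bound m n p))⟩

theorem neg (hf : MajDu r d C f) : MajDu r d C (-f) :=
  ⟨fun m n p hn => by rw [coeffAt_neg, hf.vanish m n p hn, neg_zero],
    fun m n p => by rw [coeffAt_neg, norm_neg]; exact hf.bound m n p⟩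

theorem solveU_u_mul {a : ℝ} (ha : 0 ≤ a) (hr : 0 < r) (hC : 0 ≤ C) (hf : MajDu r d C f) :
    Maj r (d - 2) C (solveU a (u * f)) := by
  refine ⟨fun m n p hn => ?_, fun m n p => ?_⟩
  · rw [coeffAt_solveU]
    rcases m with _ | m
    · simp
    · rw [coeffAt_succ_u_mul, hf.vanish m n p (by push_cast at hn; omega), zero_div]
  · rw [coeffAt_solveU]
    have hM := majorant_nonneg hr m n p
    rcases m with _ | m
    · simp
      positivity
    · have h1 : ‖(((m + 1 : ℕ) + a : ℝ) : ℂ)‖ = m + 1 + a := by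
        rw [Complex.norm_real, Real.norm_of_nonneg (by positivity), Nat.cast_succ]
      rw [coeffAt_succ_u_mul, norm_div, h1, div_le_iff₀ (by positivity)]
      calc _ ≤ C * ((m + 1) * majorant r (m + 1) n p) := hf.bound m n p
        _ ≤ C * ((m + 1 + a) * majorant r (m + 1) n p) :=
            mul_le_mul_of_nonneg_left (mul_le_mul_of_nonneg_right (by linarith) hM) hC
        _ = _ := by ring

theorem integrateW (hr : 0 < r) (hC : 0 ≤ C) (hf : MajDu r d C f) :
    Maj r d (C / 4) (integrateW f) := by
  refine ⟨fun m n p hn => by rw [coeffAt_integrateW, hf.vanish _ _ _ hn, zero_div],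
    fun m n p => ?_⟩
  rw [coeffAt_integrateW]
  have hM := majorant_nonneg hr m n p
  rcases p with _ | p
  · simp
    positivity
  · have h1 : ‖((p + 1 : ℕ) : ℂ)‖ = p + 1 := by rw [Complex.norm_natCast, Nat.cast_succ]
    rw [norm_div, h1, div_le_iff₀ (by positivity)]
    calc _ ≤ C * ((m + 1) * majorant r (m + 1) n p) := hf.bound m n p
      _ ≤ C * (1 / 4 * ((p + 1) * majorant r m n (p + 1))) :=
          mul_le_mul_of_nonneg_left (du_majorant_le_dw_majorant hr m n p) hC
      _ = _ := by ring

end MajDu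

end FormalSeries

/-! ### Causal operators -/

section Causal

variable {I V : Type*} {r : I → I → Prop}

/-- If the component `i` of `T F` depends only on the components `j` of `F` with `r j i`, where `r`
is well founded, then `T` has exactly one fixed point. -/
theorem exists_unique_fixedPoint [Zero V] (wf : WellFounded r) (T : (I → V) → I → V)
    (hT : ∀ F G i, (∀ j, r j i → F j = G j) → T F i = T G i) :
    ∃ F, T F = F ∧ ∀ G, T G = G → G = F := by
  classical
  let Φ : ∀ i, (∀ j, r j i → V) → V := fun i IH => T (fun j => if h : r j i then IH j h else 0) i
  refine ⟨wf.fix Φ, ?_, ?_⟩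
  · funext i
    rw [wf.fix_eq]
    exact hT _ _ _ fun j hj => by simp [hj]
  · intro G hG
    funext i
    induction i using wf.induction with
    | _ i ih =>
      rw [wf.fix_eq, ← hG]
      exact hT _ _ _ fun j hj => by simp [hj, ih j hj]

/-- A componentwise condition that holds for `0` and is preserved by a causal operator holds for its
fixed points: apply the operator to the truncation of the fixed point to the components below `i`. -/
theorem fixedPoint_mem [Zero V] (wf : WellFounded r) (T : (I → V) → I → V)
    (hT : ∀ F G i, (∀ j, r j i → F j = G j) → T F i = T G i) (B : I → V → Prop)
    (hB : ∀ i, B i 0) (hTB : ∀ F, (∀ i, B i (F i)) → ∀ i, B i (T F i))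
    {F : I → V} (hF : T F = F) (i : I) : B i (F i) := by
  classical
  induction i using wf.induction with
  | _ i ih =>
    have h : F i = T (fun j => if r j i then F j else 0) i := by
      conv_lhs => rw [← hF]
      exact hT _ _ _ fun j hj => by simp [hj]
    rw [h]
    refine hTB _ (fun j => ?_) i
    split_ifs with hj
    · exact ih j hj
    · exact hB j

end Causal

/-! ### Agreement of coefficients -/

namespace FormalSeries

open Finset

/-- `f` and `g` have the same coefficients of `u ^ m * v ^ n * w ^ p` for all `(m, p)` in `D`. -/
def AgreeOn (D : ℕ → ℕ → Prop) (f g : FormalSeries) : Prop :=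
  ∀ m n p, D m p → coeffAt m n p f = coeffAt m n p g

/-- The set of exponents contains, with `(m, p)`, all componentwise smaller exponents. -/
def DownClosed (D : ℕ → ℕ → Prop) : Prop :=
  ∀ m p m' p', D m p → m' ≤ m → p' ≤ p → D m' p'

/-- The exponents `(m', p')` of `u` and `w` that precede `(m, p)`; that of `w` counts first. -/
def Before (m p : ℕ) : ℕ → ℕ → Prop := fun m' p' => p' < p ∨ p' = p ∧ m' < m

/-- The exponents `(m', p')` of `u` and `w` that precede or equal `(m, p)`. -/
def UpTo (m p : ℕ) : ℕ → ℕ → Prop := fun m' p' => p' < p ∨ p' = p ∧ m' ≤ m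

/-- The exponents of `u` and `w` for which that of `w` is less than `p`. -/
def RowsBelow (p : ℕ) : ℕ → ℕ → Prop := fun _ p' => p' < p

theorem downClosed_before (m p : ℕ) : DownClosed (Before m p) := by
  intro a b a' b' h ha hb
  unfold Before at *
  omega

theorem downClosed_rowsBelow (p : ℕ) : DownClosed (RowsBelow p) := by
  intro a b a' b' h ha hb
  unfold RowsBelow at *
  omega

namespace AgreeOn

variable {D : ℕ → ℕ → Prop} {f g f' g' : FormalSeries}

theorem refl (f : FormalSeries) : AgreeOn D f f := fun _ _ _ _ => rfl

theorem add (h : AgreeOn D f f') (h' : AgreeOn D g g') : AgreeOn D (f + g) (f' + g') :=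
  fun m n p hd => by rw [coeffAt_add, coeffAt_add, h m n p hd, h' m n p hd]

theorem neg (h : AgreeOn D f f') : AgreeOn D (-f) (-f') :=
  fun m n p hd => by rw [coeffAt_neg, coeffAt_neg, h m n p hd]

theorem smul (c : ℂ) (h : AgreeOn D f f') : AgreeOn D (c • f) (c • f') :=
  fun m n p hd => by rw [coeffAt_smul, coeffAt_smul, h m n p hd]

theorem mul (hD : DownClosed D) (h : AgreeOn D f f') (h' : AgreeOn D g g') :
    AgreeOn D (f * g) (f' * g') := fun m n p hd => by
  rw [coeffAt_mul, coeffAt_mul]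
  refine sum_congr rfl fun x hx => sum_congr rfl fun y _ => sum_congr rfl fun z hz => ?_
  have hx := HasAntidiagonal.mem_antidiagonal.1 hx
  have hz := HasAntidiagonal.mem_antidiagonal.1 hz
  rw [h _ _ _ (hD _ _ _ _ hd (by omega) (by omega)),
    h' _ _ _ (hD _ _ _ _ hd (by omega) (by omega))]

theorem dv (h : AgreeOn D f f') : AgreeOn D (dv f) (dv f') :=
  fun m n p hd => by rw [coeffAt_dv, coeffAt_dv, h m _ p hd]

theorem du_before {m p : ℕ} (h : AgreeOn (UpTo m p) f f') :
    AgreeOn (Before m p) (du f) (du f') := fun a n b hd => by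
  rw [coeffAt_du, coeffAt_du, h _ _ _ (by unfold Before at hd; unfold UpTo; omega)]

theorem du_rowsBelow {p : ℕ} (h : AgreeOn (RowsBelow p) f f') :
    AgreeOn (RowsBelow p) (du f) (du f') := fun a n b hd => by
  rw [coeffAt_du, coeffAt_du, h (a + 1) n b hd]

theorem rowsBelow {m p : ℕ} (h : AgreeOn (Before m p) f f') : AgreeOn (RowsBelow p) f f' :=
  fun a n b hd => h a n b (Or.inl hd)

theorem solveU_u_mul (a : ℝ) {m p : ℕ} (h : AgreeOn (Before m p) f f') (n : ℕ) :
    coeffAt m n p (solveU a (u * f)) = coeffAt m n p (solveU a (u * f')) := by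
  rw [coeffAt_solveU, coeffAt_solveU]
  rcases m with _ | m
  · simp
  · rw [coeffAt_succ_u_mul, coeffAt_succ_u_mul, h m n p (Or.inr ⟨rfl, m.lt_succ_self⟩)]

theorem solveU (a : ℝ) {m p : ℕ} (h : AgreeOn (UpTo m p) f f') (n : ℕ) :
    coeffAt m n p (solveU a f) = coeffAt m n p (FormalSeries.solveU a f') := by
  rw [coeffAt_solveU, coeffAt_solveU, h m n p (Or.inr ⟨rfl, le_rfl⟩)]

theorem integrateW {m p : ℕ} (h : AgreeOn (RowsBelow p) f f') (n : ℕ) :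
    coeffAt m n p (integrateW f) = coeffAt m n p (FormalSeries.integrateW f') := by
  rw [coeffAt_integrateW, coeffAt_integrateW]
  rcases p with _ | p
  · simp
  · rw [h m n _ (by simp [RowsBelow])]

theorem restrictU₀ (h : AgreeOn D f f') : AgreeOn D (restrictU₀ f) (FormalSeries.restrictU₀ f') :=
  fun m n p hd => by rw [coeffAt_restrictU₀, coeffAt_restrictU₀, h m n p hd]

end AgreeOn

end FormalSeries

/-! ### The formal initial value problem as a fixed point equation -/

/-- Labels for the unknowns: the frame, connection and matter fields, the curvature components
`s_k`, and the inverse of `1 - μ ζ`. -/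
inductive Unknown : Type
  | field (x : GaugeField)
  | curv (k : Fin 5)
  | inv

namespace Unknown

open FormalSeries GaugeField

/-- The formal fields that belong to a family of series. -/
def toFields (S : Unknown → FormalSeries) : FormalFields :=
  ⟨fun x => S (field x), fun k => S (curv k)⟩

/-- The number `a` in the equation `u ∂_u f + a f = …` for the field `f`. -/
def index : GaugeField → ℕ
  | e1_01 => 1
  | e2_01 => 1
  | Γ0100 => 2
  | Γ0101 => 1
  | Γ0111 => 1
  | Γ1100 => 1
  | _ => 0

/-- The nonlinear part of the `∂_u`-equation of a field, without its factor `u`. -/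
def fieldRhs (μ : ℝ) (S : Unknown → FormalSeries) : GaugeField → FormalSeries
  | e1_01 => -2 * S (field Γ0101) + 2 * S (field Γ0100) * S (field e1_01)
  | e2_01 => 2 * S (field Γ0100) * S (field e2_01)
  | e1_11 => -2 * S (field Γ1101) + 2 * S (field Γ1100) * S (field e1_01)
  | e2_11 => 2 * S (field Γ1100) * S (field e2_01)
  | Γ0100 => (1 / 2 : ℂ) • S (curv 0) + 2 * S (field Γ0100) * S (field Γ0100)
  | Γ0101 => (1 / 2 : ℂ) • S (curv 1) + 2 * S (field Γ0100) * S (field Γ0101)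
  | Γ0111 => (1 / 2 : ℂ) • S (curv 2) + 2 * S (field Γ0100) * S (field Γ0111)
  | Γ1100 => S (curv 1) + 2 * S (field Γ1100) * S (field Γ0100)
  | Γ1101 => S (curv 2) + 2 * S (field Γ1100) * S (field Γ0101)
  | Γ1111 => S (curv 3) + 2 * S (field Γ1100) * S (field Γ0111)
  | ζ => S (field ζ0)
  | ζ0 => -(S (field ζ) * (1 + -((μ : ℂ) • S (field ζ))) * S (curv 0))
  | ζ1 => -(S (field ζ) * (1 + -((μ : ℂ) • S (field ζ))) * S (curv 1))
  | ζ2 => S (field sHat) + -2 + -(S (field ζ) * (1 + -((μ : ℂ) • S (field ζ))) * S (curv 2))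
  | sHat => -((1 + -((μ : ℂ) • S (field ζ))) * (S (curv 0) * S (field ζ2)
      + -(2 * S (curv 1) * S (field ζ1)) + S (curv 2) * S (field ζ0)))

/-- The part of the equation of a field that is not in `fieldRhs`: the linear term of the equations
with a factor `1 / u` on the right hand side, and the initial values on `{u = 0}`. -/
def fieldExtra (S : Unknown → FormalSeries) : GaugeField → FormalSeries
  | e2_01 => solveU (1 : ℕ) (S (field Γ0100))
  | e2_11 => solveU (0 : ℕ) (S (field Γ1100))
  | ζ0 => integrateW (restrictU₀ (S (field sHat) + -2))
  | sHat => integrateW (restrictU₀ (-(S (curv 4) * S (field ζ0))))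
  | _ => 0

/-- The right hand side `R_k` of the `∂_u`-equation for `s_{k+1}`. -/
def curvRhs (μ : ℝ) (S : Unknown → FormalSeries) : Fin 4 → FormalSeries
  | 0 => -4 * S (field Γ0101) * S (curv 0) + 4 * S (field Γ0100) * S (curv 1)
      + -(2 * ((μ : ℂ) • S inv) * (S (curv 0) * S (field ζ1) + -(S (curv 1) * S (field ζ0))))
  | 1 => -S (field Γ0111) * S (curv 0) + -(2 * S (field Γ0101) * S (curv 1))
      + 3 * S (field Γ0100) * S (curv 2)
      + -((1 / 2 : ℂ) • (((μ : ℂ) • S inv) * (S (curv 0) * S (field ζ2)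
          + 2 * S (curv 1) * S (field ζ1) + -(3 * S (curv 2) * S (field ζ0)))))
  | 2 => -2 * S (field Γ0111) * S (curv 1) + 2 * S (field Γ0100) * S (curv 3)
      + -(((μ : ℂ) • S inv) * (S (curv 1) * S (field ζ2) + -(S (curv 3) * S (field ζ0))))
  | 3 => -3 * S (field Γ0111) * S (curv 2) + 2 * S (field Γ0101) * S (curv 3)
      + S (field Γ0100) * S (curv 4)
      + -((1 / 2 : ℂ) • (((μ : ℂ) • S inv) * (3 * S (curv 2) * S (field ζ2)
          + -(2 * S (curv 3) * S (field ζ1)) + -(S (curv 4) * S (field ζ0)))))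

/-- The terms of the transport equation for `s_0` without derivatives. -/
def transportRhs (μ : ℝ) (S : Unknown → FormalSeries) : FormalSeries :=
  4 * S (field Γ1101) * S (curv 0) + -(4 * S (field Γ1100) * S (curv 1))
    + ((μ : ℂ) • S inv) * (S (curv 0) * S (field ζ2) + 2 * S (curv 1) * S (field ζ1)
      + -(3 * S (curv 2) * S (field ζ0)))

/-- The operator whose fixed points are the formal solutions: each equation is solved for the
derivative in `u`, or in `w` for `s_0`, and integrated. The inverse `q` of `1 - μ ζ` is
characterized by `∂_u q = μ q ^ 2 ζ_0` and `q = 1` on `{u = 0}`. -/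
def step (μ : ℝ) (D : FormalSeries) (S : Unknown → FormalSeries) : Unknown → FormalSeries
  | field x => solveU (index x) (u * fieldRhs μ S x) + fieldExtra S x
  | curv k => Fin.cases
      (D + integrateW (du (S (curv 2)) + -(S (field e1_11) * du (S (curv 0)))
        + -(S (field e2_11) * dv (S (curv 0))) + transportRhs μ S))
      (fun j => solveU (((4 - (j : ℕ) : ℤ) : ℝ) / 2) ((1 / 2 : ℂ) • dv (S (curv j.castSucc)))
        + solveU (((4 - (j : ℕ) : ℤ) : ℝ) / 2) (u * (S (field e1_01) * du (S (curv j.castSucc))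
          + S (field e2_01) * dv (S (curv j.castSucc)) + curvRhs μ S j))) k
  | inv => 1 + solveU (0 : ℕ) (u * ((μ : ℂ) • (S inv * S inv * S (field ζ0))))

/-- The order in which the coefficients of the same powers of `u` and `w` are determined. -/
def rank : Unknown → ℕ
  | field e2_01 => 1
  | field e2_11 => 1
  | field _ => 0
  | curv k => k
  | inv => 0

theorem step_curv_zero (μ : ℝ) (D : FormalSeries) (S : Unknown → FormalSeries) :
    step μ D S (curv 0) = D + integrateW (du (S (curv 2)) + -(S (field e1_11) * du (S (curv 0)))
      + -(S (field e2_11) * dv (S (curv 0))) + transportRhs μ S) := rfl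

theorem step_curv_succ (μ : ℝ) (D : FormalSeries) (S : Unknown → FormalSeries) (j : Fin 4) :
    step μ D S (curv j.succ) =
      solveU (((4 - (j : ℕ) : ℤ) : ℝ) / 2) ((1 / 2 : ℂ) • dv (S (curv j.castSucc)))
        + solveU (((4 - (j : ℕ) : ℤ) : ℝ) / 2) (u * (S (field e1_01) * du (S (curv j.castSucc))
          + S (field e2_01) * dv (S (curv j.castSucc)) + curvRhs μ S j)) := rfl

theorem step_inv (μ : ℝ) (D : FormalSeries) (S : Unknown → FormalSeries) :
    step μ D S inv = 1 + solveU (0 : ℕ) (u * ((μ : ℂ) • (S inv * S inv * S (field ζ0)))) := rfl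

section Congr

variable {D : ℕ → ℕ → Prop} {S S' : Unknown → FormalSeries}

theorem agreeOn_fieldRhs (hD : DownClosed D) (h : ∀ y, AgreeOn D (S y) (S' y)) (μ : ℝ)
    (x : GaugeField) : AgreeOn D (fieldRhs μ S x) (fieldRhs μ S' x) := by
  cases x <;> simp only [fieldRhs] <;>
    apply_rules [AgreeOn.add, AgreeOn.mul, AgreeOn.neg, AgreeOn.smul, AgreeOn.refl]

theorem agreeOn_curvRhs (hD : DownClosed D) (h : ∀ y, AgreeOn D (S y) (S' y)) (μ : ℝ)
    (j : Fin 4) : AgreeOn D (curvRhs μ S j) (curvRhs μ S' j) := by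
  fin_cases j <;> simp only [curvRhs] <;>
    apply_rules [AgreeOn.add, AgreeOn.mul, AgreeOn.neg, AgreeOn.smul, AgreeOn.refl]

theorem agreeOn_transportRhs (hD : DownClosed D) (h : ∀ y, AgreeOn D (S y) (S' y)) (μ : ℝ) :
    AgreeOn D (transportRhs μ S) (transportRhs μ S') := by
  simp only [transportRhs]
  apply_rules [AgreeOn.add, AgreeOn.mul, AgreeOn.neg, AgreeOn.smul, AgreeOn.refl]

end Congr

/-- The coefficients of `u ^ m * w ^ p` in `step μ D S x` depend only on the coefficients of `S`
that precede them. -/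
theorem coeffAt_step_congr (μ : ℝ) (D : FormalSeries) (S S' : Unknown → FormalSeries)
    (x : Unknown) (m n p : ℕ) (h : ∀ y, AgreeOn (Before m p) (S y) (S' y))
    (h' : ∀ y, rank y < rank x → AgreeOn (UpTo m p) (S y) (S' y)) :
    coeffAt m n p (step μ D S x) = coeffAt m n p (step μ D S' x) := by
  have hd := downClosed_before m p
  have hr := downClosed_rowsBelow p
  have h₀ : ∀ y, AgreeOn (RowsBelow p) (S y) (S' y) := fun y => (h y).rowsBelow
  rcases x with x | k | _
  · have key : coeffAt m n p (fieldExtra S x) = coeffAt m n p (fieldExtra S' x) := by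
      cases x with
      | e2_01 => exact (h' (field Γ0100) (by decide)).solveU _ n
      | e2_11 => exact (h' (field Γ1100) (by decide)).solveU _ n
      | ζ0 => exact (((h₀ _).add (.refl _)).restrictU₀).integrateW n
      | sHat => exact (((h₀ _).mul hr (h₀ _)).neg.restrictU₀).integrateW n
      | _ => rfl
    rw [step, step, coeffAt_add, coeffAt_add, key,
      (agreeOn_fieldRhs hd h μ x).solveU_u_mul]
  · induction k using Fin.cases with
    | zero =>
      rw [step_curv_zero, step_curv_zero, coeffAt_add, coeffAt_add]
      congr 1
      exact ((((h₀ _).du_rowsBelow.add ((h₀ _).mul hr (h₀ _).du_rowsBelow).neg).add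
        ((h₀ _).mul hr (h₀ _).dv).neg).add (agreeOn_transportRhs hr h₀ μ)).integrateW n
    | succ j =>
      have hs := h' (curv j.castSucc) (by simp [rank])
      rw [step_curv_succ, step_curv_succ, coeffAt_add, coeffAt_add]
      congr 1
      · exact (hs.dv.smul _).solveU _ n
      · refine AgreeOn.solveU_u_mul _ ?_ n
        exact (((h _).mul hd hs.du_before).add ((h _).mul hd (h _).dv)).add
          (agreeOn_curvRhs hd h μ j)
  · rw [step_inv, step_inv, coeffAt_add, coeffAt_add,
      ((((h inv).mul hd (h inv)).mul hd (h (field ζ0))).smul (μ : ℂ)).solveU_u_mul]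

/-- The position of a coefficient in the order in which the coefficients are determined. -/
def position (i : Unknown × ℕ × ℕ × ℕ) : ℕ ×ₗ ℕ ×ₗ ℕ :=
  toLex (i.2.2.2, toLex (i.2.1, rank i.1))

theorem position_lt_iff {y x : Unknown} {m' n' p' m n p : ℕ} :
    position (y, m', n', p') < position (x, m, n, p) ↔
      p' < p ∨ p' = p ∧ (m' < m ∨ m' = m ∧ rank y < rank x) := by
  simp [position, Prod.Lex.toLex_lt_toLex]

theorem wellFounded_position :
    WellFounded fun i j : Unknown × ℕ × ℕ × ℕ => position i < position j :=
  InvImage.wf position wellFounded_lt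

/-- The family of series with given coefficients. -/
def ofFun (F : Unknown × ℕ × ℕ × ℕ → ℂ) (x : Unknown) : FormalSeries :=
  ofCoeffs fun m n p => F (x, m, n, p)

/-- The operator `step` on families of coefficients. -/
def stepFun (μ : ℝ) (D : FormalSeries) (F : Unknown × ℕ × ℕ × ℕ → ℂ) :
    Unknown × ℕ × ℕ × ℕ → ℂ :=
  fun i => coeffAt i.2.1 i.2.2.1 i.2.2.2 (step μ D (ofFun F) i.1)

theorem stepFun_congr (μ : ℝ) (D : FormalSeries) (F G : Unknown × ℕ × ℕ × ℕ → ℂ)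
    (i : Unknown × ℕ × ℕ × ℕ) (h : ∀ j, position j < position i → F j = G j) :
    stepFun μ D F i = stepFun μ D G i := by
  obtain ⟨x, m, n, p⟩ := i
  refine coeffAt_step_congr μ D _ _ x m n p (fun y a b c hd => ?_) fun y hy a b c hd => ?_
  · rw [ofFun, ofFun, coeffAt_ofCoeffs, coeffAt_ofCoeffs]
    refine h _ (position_lt_iff.2 ?_)
    unfold Before at hd
    omega
  · rw [ofFun, ofFun, coeffAt_ofCoeffs, coeffAt_ofCoeffs]
    refine h _ (position_lt_iff.2 ?_)
    unfold UpTo at hd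
    omega

theorem ofFun_fixed_iff (μ : ℝ) (D : FormalSeries) (F : Unknown × ℕ × ℕ × ℕ → ℂ) :
    step μ D (ofFun F) = ofFun F ↔ stepFun μ D F = F := by
  constructor
  · intro h
    funext i
    rw [stepFun, h, ofFun, coeffAt_ofCoeffs]
  · intro h
    funext x
    refine ext_coeffAt fun m n p => ?_
    rw [ofFun, coeffAt_ofCoeffs]
    exact congrFun h (x, m, n, p)

theorem ofFun_coeffAt (S : Unknown → FormalSeries) :
    ofFun (fun i => coeffAt i.2.1 i.2.2.1 i.2.2.2 (S i.1)) = S := by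
  funext x
  exact ext_coeffAt fun m n p => by rw [ofFun, coeffAt_ofCoeffs]

theorem exists_unique_step_eq (μ : ℝ) (D : FormalSeries) :
    ∃ S, step μ D S = S ∧ ∀ S', step μ D S' = S' → S' = S := by
  obtain ⟨F, hF, hu⟩ := exists_unique_fixedPoint wellFounded_position (stepFun μ D)
    (stepFun_congr μ D)
  refine ⟨ofFun F, (ofFun_fixed_iff μ D F).2 hF, fun S' hS' => ?_⟩
  rw [← ofFun_coeffAt S'] at hS' ⊢
  rw [hu _ ((ofFun_fixed_iff μ D _).1 hS')]

/-- Bounds for the coefficients that `step` preserves hold for its fixed point. -/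
theorem bound_of_step_eq (μ : ℝ) (D : FormalSeries) (r : ℝ) (hr : 0 < r) (d : Unknown → ℤ)
    (C : Unknown → ℝ) (hC : ∀ x, 0 ≤ C x)
    (hstep : ∀ S, (∀ x, Maj r (d x) (C x) (S x)) → ∀ x, Maj r (d x) (C x) (step μ D S x))
    {S : Unknown → FormalSeries} (hS : step μ D S = S) (x : Unknown) : Maj r (d x) (C x) (S x) := by
  let B : Unknown × ℕ × ℕ × ℕ → ℂ → Prop := fun i z =>
    (2 * (i.2.1 : ℤ) + d i.1 < i.2.2.1 → z = 0) ∧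
      ‖z‖ ≤ C i.1 * majorant r i.2.1 i.2.2.1 i.2.2.2
  have hB : ∀ F : Unknown × ℕ × ℕ × ℕ → ℂ, (∀ i, B i (F i)) → ∀ x, Maj r (d x) (C x) (ofFun F x) :=
    fun F hF x => ⟨fun m n p h => by rw [ofFun, coeffAt_ofCoeffs]; exact (hF (x, m, n, p)).1 h,
      fun m n p => by rw [ofFun, coeffAt_ofCoeffs]; exact (hF (x, m, n, p)).2⟩
  rw [← ofFun_coeffAt S] at hS ⊢
  refine hB _ (fun i => ?_) x
  refine fixedPoint_mem wellFounded_position (stepFun μ D) (stepFun_congr μ D) B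
    (fun i => ⟨fun _ => rfl, ?_⟩) (fun F hF i => ?_) ((ofFun_fixed_iff μ D _).1 hS) i
  · rw [norm_zero]
    exact mul_nonneg (hC _) (majorant_nonneg hr _ _ _)
  · have h := hstep _ (hB F hF) i.1
    exact ⟨fun hi => h.vanish _ _ _ hi, h.bound _ _ _⟩

end Unknown

/-! ### Formal solutions and fixed points -/

namespace FormalSeries

open Finset

theorem solveU_add (a : ℝ) (f g : FormalSeries) : solveU a (f + g) = solveU a f + solveU a g :=
  ext_coeffAt fun m n p => by simp [add_div]

theorem eq_solveU_nat_iff {a : ℕ} (ha : 0 < a) (f h : FormalSeries) :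
    f = solveU a h ↔ u * du f + a * f = h := by
  rw [eq_solveU_iff (by exact_mod_cast ha)]
  have : (((a : ℕ) : ℝ) : ℂ) • f = a * f := by
    rw [Complex.ofReal_natCast, Nat.cast_smul_eq_nsmul, nsmul_eq_mul]
  rw [this]

theorem eqOnU₀_iff_agreeOn (f g : FormalSeries) :
    EqOnU₀ f g ↔ AgreeOn (fun m _ => m = 0) f g :=
  ⟨fun h m n p hm => by subst hm; exact h n p, fun h n p => h 0 n p rfl⟩

theorem eqOnU₀_mul {f f' g g' : FormalSeries} (h : EqOnU₀ f f') (h' : EqOnU₀ g g') :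
    EqOnU₀ (f * g) (f' * g') := by
  rw [eqOnU₀_iff_agreeOn] at *
  exact h.mul (fun _ _ _ _ h₀ h₁ _ => Nat.le_zero.1 (h₀ ▸ h₁)) h'

/-- A homogeneous linear equation `∂_u y = a y` with zero initial values has only the zero solution. -/
theorem eq_zero_of_du_eq_mul {a y : FormalSeries} (h : du y = a * y) (h₀ : EqOnU₀ y 0) : y = 0 := by
  suffices ∀ m n p, coeffAt m n p y = 0 from ext_coeffAt fun m n p => by rw [this, coeffAt_zero]
  intro m
  induction m using Nat.strong_induction_on with
  | _ m ih =>
    intro n p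
    rcases m with _ | m
    · simpa using h₀ n p
    · have h1 := congrArg (coeffAt m n p) h
      rw [coeffAt_du, coeffAt_mul, sum_eq_zero] at h1
      · exact (mul_eq_zero.1 h1).resolve_left (by exact_mod_cast m.succ_ne_zero)
      · intro x hx
        have hx := HasAntidiagonal.mem_antidiagonal.1 hx
        exact sum_eq_zero fun y _ => sum_eq_zero fun z _ => by
          rw [ih x.2 (by omega), mul_zero]

theorem du_add (f g : FormalSeries) : du (f + g) = du f + du g := map_add _ _ _

theorem du_sub (f g : FormalSeries) : du (f - g) = du f - du g := map_sub _ _ _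

theorem du_smul (c : ℂ) (f : FormalSeries) : du (c • f) = c • du f :=
  Derivation.map_smul _ c f

theorem du_one : du 1 = 0 := MvPowerSeries.pderiv_one

theorem du_two : du 2 = 0 := by
  rw [show (2 : FormalSeries) = 1 + 1 by norm_num, du_add, du_one, add_zero]

theorem dw_sub_two (f : FormalSeries) : dw (f - 2) = dw f := by
  rw [show (2 : FormalSeries) = 1 + 1 by norm_num, dw, map_sub, map_add,
    MvPowerSeries.pderiv_one, add_zero, sub_zero, dw]

theorem du_mul (f g : FormalSeries) : du (f * g) = f * du g + g * du f := by
  simp [du, Derivation.leibniz]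

/-- The inverse `q` of `1 - c f` is characterized by `∂_u q = c q ^ 2 ∂_u f` and by `q = 1` on
`{u = 0}`, if `f = 0` there. -/
theorem eq_inv_one_sub_smul_iff (c : ℂ) (f q : FormalSeries) (hf : EqOnU₀ f 0) :
    q = (1 - c • f)⁻¹ ↔ q = 1 + solveU (0 : ℕ) (u * (c • (q * q * du f))) := by
  have hc : MvPowerSeries.constantCoeff (1 - c • f) ≠ 0 := by
    have : MvPowerSeries.constantCoeff f = 0 := by
      rw [← MvPowerSeries.coeff_zero_eq_constantCoeff_apply, coeff_eq_coeffAt]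
      simpa using hf 0 0
    simp [this]
  have h1 : EqOnU₀ (1 - c • f) 1 := fun n p => by simp [hf n p]
  rw [MvPowerSeries.eq_inv_iff_mul_eq_one hc, add_comm, ← sub_eq_iff_eq_add, Nat.cast_zero,
    eq_solveU_zero_u_mul_iff, du_sub, du_one, sub_zero]
  constructor
  · intro h
    constructor
    · have h2 := congrArg du h
      rw [du_mul, du_sub, du_one, zero_sub, du_smul] at h2
      rw [Algebra.smul_def] at h h2 ⊢
      rw [Algebra.smul_def] at h2
      linear_combination q * h2 - du q * h
    · intro n p
      have h2 := eqOnU₀_mul (fun n p => rfl : EqOnU₀ q q) h1 n p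
      rw [h, mul_one] at h2
      rw [coeffAt_sub, ← h2, sub_self, coeffAt_zero]
  · rintro ⟨h, h0⟩
    have hq : EqOnU₀ q 1 := fun n p => by
      have := h0 n p
      rwa [coeffAt_sub, coeffAt_zero, sub_eq_zero] at this
    refine sub_eq_zero.1 (eq_zero_of_du_eq_mul (a := c • (q * du f)) ?_ ?_)
    · rw [du_sub, du_mul, du_sub, du_one, du_smul, h]
      simp only [Algebra.smul_def]
      ring
    · intro n p
      have := eqOnU₀_mul hq h1 n p
      rw [mul_one] at this
      rw [coeffAt_sub, this, sub_self, coeffAt_zero]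

end FormalSeries

namespace Unknown

open FormalSeries GaugeField FormalFields

theorem field_eq_of_index_zero {μ : ℝ} {D : FormalSeries} {S : Unknown → FormalSeries}
    {x : GaugeField} (hx : index x = 0) (hx' : fieldExtra S x = 0) :
    step μ D S (field x) = S (field x) ↔
      du (S (field x)) = fieldRhs μ S x ∧ EqOnU₀ (S (field x)) 0 := by
  rw [eq_comm, step, hx, hx', add_zero, Nat.cast_zero, eq_solveU_zero_u_mul_iff]

theorem field_eq_of_index_pos {μ : ℝ} {D : FormalSeries} {S : Unknown → FormalSeries}
    {x : GaugeField} (hx : 0 < index x) (hx' : fieldExtra S x = 0) :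
    step μ D S (field x) = S (field x) ↔
      u * du (S (field x)) + index x * S (field x) = u * fieldRhs μ S x := by
  rw [eq_comm, step, hx', add_zero, eq_solveU_nat_iff hx]

theorem eqOnU₀_zero_of_index_pos' {f g h : FormalSeries} {a : ℕ} (ha : 0 < a) (hh : EqOnU₀ h 0)
    (e : u * du f + a * f = u * g + h) : EqOnU₀ f 0 := by
  rw [← eq_solveU_nat_iff ha] at e
  intro n p
  rw [e, coeffAt_solveU, coeffAt_add, coeffAt_zero_u_mul, hh n p]
  simp

theorem eqOnU₀_zero_of_index_pos {f g : FormalSeries} {a : ℕ} (ha : 0 < a)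
    (h : u * du f + a * f = u * g) : EqOnU₀ f 0 :=
  eqOnU₀_zero_of_index_pos' ha (fun _ _ => rfl : EqOnU₀ 0 0) (by rw [h, add_zero])

theorem field_eq_of_integrateW {μ : ℝ} {D h : FormalSeries} {S : Unknown → FormalSeries}
    {x : GaugeField} (hx : index x = 0) (hx' : fieldExtra S x = integrateW (restrictU₀ h)) :
    step μ D S (field x) = S (field x) ↔
      du (S (field x)) = fieldRhs μ S x ∧ EqOnU₀ (dw (S (field x))) h ∧ EqOnI (S (field x)) 0 := by
  rw [eq_comm, step, hx, hx', Nat.cast_zero, eq_solveU_add_integrateW_iff]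

theorem field_e2_01_iff {μ : ℝ} {D : FormalSeries} {S : Unknown → FormalSeries} :
    step μ D S (field e2_01) = S (field e2_01) ↔
      u * du (S (field e2_01)) + (1 : ℕ) * S (field e2_01) =
        u * fieldRhs μ S e2_01 + S (field Γ0100) := by
  rw [eq_comm, step, fieldExtra, index, ← solveU_add, eq_solveU_nat_iff one_pos]

theorem field_e2_11_iff {μ : ℝ} {D : FormalSeries} {S : Unknown → FormalSeries}
    (h : EqOnU₀ (S (field Γ1100)) 0) :
    step μ D S (field e2_11) = S (field e2_11) ↔
      u * du (S (field e2_11)) = u * fieldRhs μ S e2_11 + S (field Γ1100) ∧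
        EqOnU₀ (S (field e2_11)) 0 := by
  rw [eq_comm, step, show fieldExtra S e2_11 = solveU (0 : ℕ) (S (field Γ1100)) from rfl,
    show index e2_11 = 0 from rfl, ← solveU_add, Nat.cast_zero, eq_solveU_zero_iff]
  intro n p
  rw [coeffAt_add, coeffAt_zero_u_mul, h n p, coeffAt_zero, add_zero]

theorem curv_succ_eq_iff {μ : ℝ} {D : FormalSeries} {S : Unknown → FormalSeries} (j : Fin 4) :
    step μ D S (curv j.succ) = S (curv j.succ) ↔
      u * du (S (curv j.succ)) + (4 - (j : ℕ)) * ((1 / 2 : ℂ) • S (curv j.succ)) =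
        (1 / 2 : ℂ) • dv (S (curv j.castSucc)) +
          u * (S (field e1_01) * du (S (curv j.castSucc))
          + S (field e2_01) * dv (S (curv j.castSucc)) + curvRhs μ S j) := by
  have hj : (0 : ℝ) < ((4 - (j : ℕ) : ℤ) : ℝ) / 2 := by
    have := j.isLt
    have : (0 : ℤ) < 4 - (j : ℕ) := by omega
    have : (0 : ℝ) < ((4 - (j : ℕ) : ℤ) : ℝ) := by exact_mod_cast this
    linarith
  rw [eq_comm, step_curv_succ, ← solveU_add, eq_solveU_iff hj]
  have : (((((4 - (j : ℕ) : ℤ) : ℝ) / 2 : ℝ)) : ℂ) • S (curv j.succ) =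
      (4 - (j : ℕ)) * ((1 / 2 : ℂ) • S (curv j.succ)) := by
    rw [Algebra.smul_def, Algebra.smul_def, ← mul_assoc]
    congr 1
    push_cast
    rw [div_eq_mul_one_div, map_mul, map_sub, map_natCast, map_ofNat]
  rw [this]

/-- The datum on `{w = 0}` as a formal series. -/
def datum (s₀ : ℂ × ℂ → ℂ) : FormalSeries :=
  ofCoeffs fun m n p => if p = 0 then taylorDeriv m n s₀ / ((m ! : ℂ) * (n ! : ℂ)) else 0

theorem coeffAt_datum_succ (s₀ : ℂ × ℂ → ℂ) (m n p : ℕ) : coeffAt m n (p + 1) (datum s₀) = 0 := by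
  simp [datum]

theorem derivAt_eq_taylorDeriv_iff (s₀ : ℂ × ℂ → ℂ) (m n : ℕ) (f : FormalSeries) :
    derivAt m n 0 f = taylorDeriv m n s₀ ↔ coeffAt m n 0 f = coeffAt m n 0 (datum s₀) := by
  have hm : (m ! : ℂ) ≠ 0 := by exact_mod_cast m.factorial_ne_zero
  have hn : (n ! : ℂ) ≠ 0 := by exact_mod_cast n.factorial_ne_zero
  rw [datum, coeffAt_ofCoeffs, if_pos rfl, eq_div_iff (mul_ne_zero hm hn), derivAt]
  simp only [Nat.factorial_zero, Nat.cast_one, mul_one]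
  rw [mul_comm]

/-- The family of series that belongs to formal fields. -/
def ofFields (μ : ℝ) (G : FormalFields) : Unknown → FormalSeries
  | field x => G.f x
  | curv k => G.s k
  | inv => (G.factor μ)⁻¹

theorem isFormalSolution_toFields {μ : ℝ} {s₀ : ℂ × ℂ → ℂ} {S : Unknown → FormalSeries}
    (hS : step μ (datum s₀) S = S) : (toFields S).IsFormalSolution μ s₀ := by
  have H := fun x => congrFun hS x
  have hζ := (field_eq_of_index_zero rfl rfl).1 (H (field ζ))
  have hκ : (toFields S).κ μ = (μ : ℂ) • S inv := by
    have h := (eq_inv_one_sub_smul_iff (μ : ℂ) (S (field ζ)) (S inv) hζ.2).2 (by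
      rw [hζ.1]; exact (H inv).symm)
    rw [κ, h]; rfl
  have p1 := (field_eq_of_index_pos (by decide) rfl).1 (H (field e1_01))
  have p3 := (field_eq_of_index_zero rfl rfl).1 (H (field e1_11))
  have p5 := (field_eq_of_index_pos (by decide) rfl).1 (H (field Γ0100))
  have p6 := (field_eq_of_index_pos (by decide) rfl).1 (H (field Γ0101))
  have p7 := (field_eq_of_index_pos (by decide) rfl).1 (H (field Γ0111))
  have p8 := (field_eq_of_index_pos (by decide) rfl).1 (H (field Γ1100))
  have p9 := (field_eq_of_index_zero rfl rfl).1 (H (field Γ1101))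
  have p10 := (field_eq_of_index_zero rfl rfl).1 (H (field Γ1111))
  have p12 := (field_eq_of_integrateW rfl rfl).1 (H (field ζ0))
  have p13 := (field_eq_of_index_zero rfl rfl).1 (H (field ζ1))
  have p14 := (field_eq_of_index_zero rfl rfl).1 (H (field ζ2))
  have p15 := (field_eq_of_integrateW rfl rfl).1 (H (field sHat))
  have i5 := eqOnU₀_zero_of_index_pos (by decide) p5
  have i8 := eqOnU₀_zero_of_index_pos (by decide) p8
  have p2 := field_e2_01_iff.1 (H (field e2_01))
  have p4 := (field_e2_11_iff i8).1 (H (field e2_11))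
  have i2 := eqOnU₀_zero_of_index_pos' (by decide) i5 p2
  have q0 := (eq_add_integrateW_iff _ _ _ (coeffAt_datum_succ s₀)).1 (H (curv 0)).symm
  have q1 : u * du (S (curv 1)) + (4 - (0 : ℕ)) * ((1 / 2 : ℂ) • S (curv 1)) =
      (1 / 2 : ℂ) • dv (S (curv 0)) + u * (S (field e1_01) * du (S (curv 0))
        + S (field e2_01) * dv (S (curv 0)) + curvRhs μ S 0) :=
    (curv_succ_eq_iff 0).1 (H (curv 1))
  have q2 : u * du (S (curv 2)) + (4 - (1 : ℕ)) * ((1 / 2 : ℂ) • S (curv 2)) =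
      (1 / 2 : ℂ) • dv (S (curv 1)) + u * (S (field e1_01) * du (S (curv 1))
        + S (field e2_01) * dv (S (curv 1)) + curvRhs μ S 1) :=
    (curv_succ_eq_iff 1).1 (H (curv 2))
  have q3 : u * du (S (curv 3)) + (4 - (2 : ℕ)) * ((1 / 2 : ℂ) • S (curv 3)) =
      (1 / 2 : ℂ) • dv (S (curv 2)) + u * (S (field e1_01) * du (S (curv 2))
        + S (field e2_01) * dv (S (curv 2)) + curvRhs μ S 2) :=
    (curv_succ_eq_iff 2).1 (H (curv 3))
  have q4 : u * du (S (curv 4)) + (4 - (3 : ℕ)) * ((1 / 2 : ℂ) • S (curv 4)) =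
      (1 / 2 : ℂ) • dv (S (curv 3)) + u * (S (field e1_01) * du (S (curv 3))
        + S (field e2_01) * dv (S (curv 3)) + curvRhs μ S 3) :=
    (curv_succ_eq_iff 3).1 (H (curv 4))
  refine ⟨fun m n => (derivAt_eq_taylorDeriv_iff _ _ _ _).2 (q0.2 m n), ?_, ?_, ?_⟩
  · constructor <;> try simp only [hκ]
    all_goals
      simp only [toFields, factor, sScalar, du_sub, du_two, Algebra.smul_def, fieldRhs, curvRhs,
        index] at *
    · linear_combination p1
    · linear_combination p2
    · linear_combination p3.1
    · linear_combination p4.1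
    · linear_combination p5
    · linear_combination p6
    · linear_combination p7
    · linear_combination p8
    · linear_combination p9.1
    · linear_combination p10.1
    · linear_combination hζ.1
    · linear_combination p12.1
    · linear_combination p13.1
    · linear_combination p14.1
    · linear_combination p15.1
    · push_cast at q1
      linear_combination q1
    · push_cast at q2
      linear_combination q2
    · push_cast at q3
      linear_combination q3
    · push_cast at q4
      linear_combination q4
  · rw [TransportEquation, hκ]
    simp only [toFields, transportRhs] at *
    linear_combination q0.1
  · refine ⟨eqOnU₀_zero_of_index_pos (by decide) p1, i2, p3.2, p4.2, i5,
      eqOnU₀_zero_of_index_pos (by decide) p6, eqOnU₀_zero_of_index_pos (by decide) p7, i8,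
      p9.2, p10.2, hζ.2, p13.2, p14.2, p12.2.2, ?_, ?_, ?_, ?_⟩
    · intro n
      have := p15.2.2 n
      simp only [sScalar, toFields, coeffAt_sub, this, coeffAt_neg, coeffAt_zero, zero_sub]
    · rw [sScalar, sub_eq_add_neg]
      exact p12.2.1
    · rw [sScalar, dw_sub_two]
      exact p15.2.1
    · intro k n p
      have h := congrArg (coeffAt 0 n p) ((curv_succ_eq_iff k).1 (H (curv k.succ)))
      have e : ((4 : FormalSeries) - (k : ℕ)) * ((1 / 2 : ℂ) • S (curv k.succ)) =
          ((4 - ((k : ℕ) : ℂ)) / 2) • S (curv k.succ) := by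
        rw [Algebra.smul_def, Algebra.smul_def, ← mul_assoc, div_eq_mul_one_div (4 - ((k : ℕ) : ℂ)),
          map_mul, map_sub, map_natCast, map_ofNat]
      rw [e] at h
      simp only [coeffAt_add, coeffAt_zero_u_mul, coeffAt_smul, toFields] at h ⊢
      linear_combination -2 * h

theorem step_ofFields {μ : ℝ} {s₀ : ℂ × ℂ → ℂ} {G : FormalFields}
    (hG : G.IsFormalSolution μ s₀) : step μ (datum s₀) (ofFields μ G) = ofFields μ G := by
  obtain ⟨hd, hu, ht, hi⟩ := hG
  have hζ : du (G.f ζ) = G.f ζ0 := sub_eq_zero.1 hu.eq_ζ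
  have hκ : G.κ μ = (μ : ℂ) • ofFields μ G inv := rfl
  funext x
  rcases x with x | k | _
  · cases x with
    | e1_01 =>
      refine (field_eq_of_index_pos (by decide) rfl).2 ?_
      have h := hu.eq_e1_01
      simp only [ofFields, fieldRhs, index]
      linear_combination h
    | e2_01 =>
      refine field_e2_01_iff.2 ?_
      have h := hu.eq_e2_01
      simp only [ofFields, fieldRhs]
      linear_combination h
    | e1_11 =>
      refine (field_eq_of_index_zero rfl rfl).2 ⟨?_, hi.ic_e1_11⟩
      exact hu.eq_e1_11
    | e2_11 =>
      refine (field_e2_11_iff hi.ic_Γ1100).2 ⟨?_, hi.ic_e2_11⟩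
      have h := hu.eq_e2_11
      simp only [ofFields, fieldRhs]
      linear_combination h
    | Γ0100 =>
      refine (field_eq_of_index_pos (by decide) rfl).2 ?_
      have h := hu.eq_Γ0100
      simp only [ofFields, fieldRhs, index, Algebra.smul_def] at h ⊢
      linear_combination h
    | Γ0101 =>
      refine (field_eq_of_index_pos (by decide) rfl).2 ?_
      have h := hu.eq_Γ0101
      simp only [ofFields, fieldRhs, index, Algebra.smul_def] at h ⊢
      linear_combination h
    | Γ0111 =>
      refine (field_eq_of_index_pos (by decide) rfl).2 ?_
      have h := hu.eq_Γ0111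
      simp only [ofFields, fieldRhs, index, Algebra.smul_def] at h ⊢
      linear_combination h
    | Γ1100 =>
      refine (field_eq_of_index_pos (by decide) rfl).2 ?_
      have h := hu.eq_Γ1100
      simp only [ofFields, fieldRhs, index]
      linear_combination h
    | Γ1101 =>
      refine (field_eq_of_index_zero rfl rfl).2 ⟨?_, hi.ic_Γ1101⟩
      have h := hu.eq_Γ1101
      simp only [ofFields, fieldRhs]
      linear_combination h
    | Γ1111 =>
      refine (field_eq_of_index_zero rfl rfl).2 ⟨?_, hi.ic_Γ1111⟩
      have h := hu.eq_Γ1111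
      simp only [ofFields, fieldRhs]
      linear_combination h
    | ζ => exact (field_eq_of_index_zero rfl rfl).2 ⟨hζ, hi.ic_ζ⟩
    | ζ0 =>
      refine (field_eq_of_integrateW rfl rfl).2 ⟨?_, ?_, hi.ic_ζ0_I⟩
      · have h := hu.eq_ζ0
        simp only [ofFields, fieldRhs, factor] at h ⊢
        linear_combination h
      · have h := hi.ic_dw_ζ0
        rwa [sScalar, sub_eq_add_neg] at h
    | ζ1 =>
      refine (field_eq_of_index_zero rfl rfl).2 ⟨?_, hi.ic_ζ1⟩
      have h := hu.eq_ζ1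
      simp only [ofFields, fieldRhs, factor] at h ⊢
      linear_combination h
    | ζ2 =>
      refine (field_eq_of_index_zero rfl rfl).2 ⟨?_, hi.ic_ζ2⟩
      have h := hu.eq_ζ2
      simp only [ofFields, fieldRhs, factor, sScalar] at h ⊢
      linear_combination h
    | sHat =>
      refine (field_eq_of_integrateW rfl rfl).2 ⟨?_, ?_, ?_⟩
      · have h := hu.eq_sScalar
        simp only [ofFields, fieldRhs, factor, sScalar, du_sub, du_two] at h ⊢
        linear_combination h
      · have h := hi.ic_dw_s
        rwa [sScalar, dw_sub_two] at h
      · intro n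
        have h := hi.ic_s_I n
        rw [sScalar, coeffAt_sub, coeffAt_neg] at h
        change coeffAt 0 n 0 (G.f sHat) = _
        rw [coeffAt_zero]
        linear_combination h
  · induction k using Fin.cases with
    | zero =>
      refine ((eq_add_integrateW_iff _ _ _ (coeffAt_datum_succ s₀)).2
        ⟨?_, fun m n => (derivAt_eq_taylorDeriv_iff _ _ _ _).1 (hd m n)⟩).symm
      rw [TransportEquation, hκ] at ht
      simp only [ofFields, transportRhs] at ht ⊢
      linear_combination ht
    | succ k =>
      refine (curv_succ_eq_iff k).2 ?_
      fin_cases k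
      · have h := hu.eq_s1
        simp [ofFields, curvRhs, hκ, Algebra.smul_def] at h ⊢
        linear_combination h
      · have h := hu.eq_s2
        simp [ofFields, curvRhs, hκ, Algebra.smul_def] at h ⊢
        linear_combination h
      · have h := hu.eq_s3
        simp [ofFields, curvRhs, hκ, Algebra.smul_def] at h ⊢
        linear_combination h
      · have h := hu.eq_s4
        simp [ofFields, curvRhs, hκ, Algebra.smul_def] at h ⊢
        linear_combination h
  · have h := (eq_inv_one_sub_smul_iff (μ : ℂ) (G.f ζ) (ofFields μ G inv) hi.ic_ζ).1 rfl
    rw [hζ] at h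
    exact h.symm

theorem exists_unique_isFormalSolution (μ : ℝ) (s₀ : ℂ × ℂ → ℂ) :
    ∃ S, step μ (datum s₀) S = S ∧ (toFields S).IsFormalSolution μ s₀ ∧
      ∀ G : FormalFields, G.IsFormalSolution μ s₀ → G = toFields S := by
  obtain ⟨S, hS, hu⟩ := exists_unique_step_eq μ (datum s₀)
  refine ⟨S, hS, isFormalSolution_toFields hS, fun G hG => ?_⟩
  rw [← hu _ (step_ofFields hG)]
  rfl

end Unknown

/-! ### The grading, and bounds for the right hand sides -/

namespace Unknown

open FormalSeries GaugeField

/-- The coefficient of `u ^ m` of an unknown has degree at most `2 m + weight` in `v`. With these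
weights, and weight `-2` for `u`, no term of an equation has a larger weight than its left hand
side. -/
def weight : Unknown → ℤ
  | field e1_01 => -1
  | field e2_01 => 2
  | field e1_11 => -2
  | field e2_11 => 1
  | field Γ0100 => 2
  | field Γ0101 => 1
  | field Γ0111 => 0
  | field Γ1100 => 1
  | field Γ1101 => 0
  | field Γ1111 => -1
  | field ζ => -2
  | field ζ0 => 0
  | field ζ1 => -1
  | field ζ2 => -2
  | field sHat => 0
  | curv k => 4 - (k : ℕ)
  | inv => 0

/-- The bounds for the unknowns in terms of `A`, if the fields are bounded by `1`. -/
def size (A : ℝ) : Unknown → ℝ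
  | field _ => 1
  | curv k => ((k : ℕ) + 1) * A
  | inv => 2

/-- `Q` maps families of series that are bounded by `size A` to series that are bounded by a constant
which does not depend on the rate `r` of the majorant. -/
def Tame (A : ℝ) (d : ℤ) (Q : (Unknown → FormalSeries) → FormalSeries) : Prop :=
  ∃ C : ℝ, ∀ r : ℝ, 1 ≤ r → ∀ S : Unknown → FormalSeries,
    (∀ x, Maj r (weight x) (size A x) (S x)) → Maj r d C (Q S)

namespace Tame

variable {A : ℝ} {d e : ℤ} {Q R : (Unknown → FormalSeries) → FormalSeries}

theorem mono (h : Tame A d Q) (hd : d ≤ e) : Tame A e Q := by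
  obtain ⟨C, h⟩ := h
  exact ⟨C, fun r hr S hS => (h r hr S hS).mono (by linarith) hd le_rfl⟩

theorem atom (x : Unknown) : Tame A (weight x) (fun S => S x) :=
  ⟨size A x, fun _ _ _ hS => hS x⟩

theorem one : Tame A 0 (fun _ => 1) := ⟨1, fun _ hr _ _ => Maj.one (by linarith)⟩

theorem ofNat (k : ℕ) [k.AtLeastTwo] : Tame A 0 (fun _ => (OfNat.ofNat k : FormalSeries)) :=
  ⟨k, fun _ hr _ _ => Maj.ofNat (by linarith) k⟩

theorem add (hQ : Tame A d Q) (hR : Tame A e R) : Tame A (max d e) (fun S => Q S + R S) := by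
  obtain ⟨C, hQ⟩ := hQ
  obtain ⟨D, hR⟩ := hR
  exact ⟨C + D, fun r hr S hS => (hQ r hr S hS).add (hR r hr S hS)⟩

theorem mul (hQ : Tame A d Q) (hR : Tame A e R) : Tame A (d + e) (fun S => Q S * R S) := by
  obtain ⟨C, hQ⟩ := hQ
  obtain ⟨D, hR⟩ := hR
  exact ⟨512 * (C * D), fun r hr S hS => (hQ r hr S hS).mul (by linarith) (hR r hr S hS)⟩

theorem neg (hQ : Tame A d Q) : Tame A d (fun S => -Q S) := by
  obtain ⟨C, hQ⟩ := hQ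
  exact ⟨C, fun r hr S hS => (hQ r hr S hS).neg⟩

theorem smul (c : ℂ) (hQ : Tame A d Q) : Tame A d (fun S => c • Q S) := by
  obtain ⟨C, hQ⟩ := hQ
  exact ⟨‖c‖ * C, fun r hr S hS => (hQ r hr S hS).smul c⟩

end Tame

theorem tame_fieldRhs (A μ : ℝ) (x : GaugeField) :
    Tame A (weight (field x) + 2) (fun S => fieldRhs μ S x) := by
  cases x <;> simp only [fieldRhs] <;> apply Tame.mono
  all_goals try
    apply_rules [Tame.add, Tame.mul, Tame.neg, Tame.smul, Tame.atom, Tame.one, Tame.ofNat]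
  all_goals decide

theorem tame_curvRhs (A μ : ℝ) (j : Fin 4) :
    Tame A (weight (curv j.succ) + 2) (fun S => curvRhs μ S j) := by
  fin_cases j <;> simp only [curvRhs] <;> apply Tame.mono
  all_goals try
    apply_rules [Tame.add, Tame.mul, Tame.neg, Tame.smul, Tame.atom, Tame.one, Tame.ofNat]
  all_goals decide

theorem tame_transportRhs (A μ : ℝ) : Tame A 4 (fun S => transportRhs μ S) := by
  simp only [transportRhs]
  apply Tame.mono
  all_goals try
    apply_rules [Tame.add, Tame.mul, Tame.neg, Tame.smul, Tame.atom, Tame.one, Tame.ofNat]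
  all_goals decide

end Unknown

/-! ### Bounds that the fixed point equation preserves -/

namespace FormalSeries

/-- Integration in `u` gains a factor `1 / r`. -/
theorem Maj.solveU_u_mul {r C : ℝ} {d : ℤ} {f : FormalSeries} (hr : 0 < r) {a : ℝ} (ha : 0 ≤ a)
    (hf : Maj r (d + 2) C f) : Maj r d (4 * C / r) (FormalSeries.solveU a (u * f)) := by
  have h := (hf.majDu hr).solveU_u_mul ha hr (by have := hf.nonneg; positivity)
  exact h.mono hr (by omega) le_rfl

end FormalSeries

instance : Finite GaugeField :=
  Finite.of_surjective (![.e1_01, .e2_01, .e1_11, .e2_11, .Γ0100, .Γ0101, .Γ0111, .Γ1100, .Γ1101,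
    .Γ1111, .ζ, .ζ0, .ζ1, .ζ2, .sHat] : Fin 15 → GaugeField) (by
      intro x
      cases x
      exacts [⟨0, rfl⟩, ⟨1, rfl⟩, ⟨2, rfl⟩, ⟨3, rfl⟩, ⟨4, rfl⟩, ⟨5, rfl⟩, ⟨6, rfl⟩, ⟨7, rfl⟩, ⟨8, rfl⟩,
        ⟨9, rfl⟩, ⟨10, rfl⟩, ⟨11, rfl⟩, ⟨12, rfl⟩, ⟨13, rfl⟩, ⟨14, rfl⟩])

namespace Unknown

open FormalSeries GaugeField

theorem exists_forall_le {ι : Type*} [Finite ι] (c : ι → ℝ) : ∃ K, ∀ x, c x ≤ K := by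
  obtain ⟨K, hK⟩ := (Set.finite_range c).bddAbove
  exact ⟨K, fun x => hK ⟨x, rfl⟩⟩

/-- The bounds for the unknowns: `c x / r` for the fields, where `r` is the rate of the majorant. -/
def fieldBound (A : ℝ) (c : GaugeField → ℝ) (r : ℝ) : Unknown → ℝ
  | field x => c x / r
  | curv k => ((k : ℕ) + 1) * A
  | inv => 2

section Preserved

variable {A μ : ℝ} {c : GaugeField → ℝ} {S : Unknown → FormalSeries} {r : ℝ}

theorem maj_size_of_maj_fieldBound (hr : 0 < r) (hc : ∀ x, c x ≤ r)
    (hS : ∀ x, Maj r (weight x) (fieldBound A c r x) (S x)) (x : Unknown) :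
    Maj r (weight x) (size A x) (S x) := by
  refine (hS x).mono hr le_rfl ?_
  rcases x with x | k | _
  · exact (div_le_one hr).2 (hc x)
  · exact le_rfl
  · exact le_rfl

/-- The right hand sides of the field equations are bounded in terms of `A` alone, as long as the
fields are bounded by `1`; their integrals are then of order `1 / r`. -/
theorem exists_field_constants (A μ : ℝ) :
    ∃ c : GaugeField → ℝ, (∀ x, 0 < c x) ∧ ∀ (D : FormalSeries) (r : ℝ), 1 ≤ r → (∀ x, c x ≤ r) →
      ∀ S : Unknown → FormalSeries, (∀ x, Maj r (weight x) (fieldBound A c r x) (S x)) →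
        ∀ x, Maj r (weight (field x)) (c x / r) (step μ D S (field x)) := by
  choose C hC using fun x => tame_fieldRhs A μ x
  obtain ⟨Z, hZ⟩ : Tame A 0 (fun S => S (field sHat) + -2) :=
    ((Tame.atom _).add (Tame.ofNat 2).neg).mono (by decide)
  obtain ⟨E, hE⟩ : Tame A 0 (fun S => -(S (curv 4) * S (field ζ0))) :=
    ((Tame.atom _).mul (Tame.atom _)).neg.mono (by decide)
  -- `b` bounds the integrals of the right hand sides, `e` the additional terms; those of `e2_01` and
  -- `e2_11` are bounded by the previous constants of `Γ0100` and `Γ1100`.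
  let b : GaugeField → ℝ := fun x => 4 * |C x| + 1
  have hb : ∀ x, 0 < b x := fun x => by positivity
  let e : GaugeField → ℝ := fun x => match x with
    | e2_01 => b Γ0100
    | e2_11 => b Γ1100
    | ζ0 => 4 * |Z|
    | sHat => 4 * |E|
    | _ => 0
  have he : ∀ x, 0 ≤ e x := by
    intro x
    cases x <;> simp only [e] <;> first | exact (hb _).le | positivity
  refine ⟨fun x => b x + e x, fun x => add_pos_of_pos_of_nonneg (hb x) (he x), ?_⟩
  intro D r hr hc S hS x
  have hr0 : 0 < r := by linarith
  have hS' := maj_size_of_maj_fieldBound hr0 hc hS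
  have h1 : Maj r (weight (field x)) (b x / r) (solveU (index x) (u * fieldRhs μ S x)) :=
    ((hC x r hr S hS').solveU_u_mul hr0 (Nat.cast_nonneg _)).mono hr0 le_rfl (by
      have := le_abs_self (C x)
      simp only [b]
      gcongr
      linarith)
  have h2 : Maj r (weight (field x)) (e x / r) (fieldExtra S x) := by
    have h0 : ∀ d, Maj r d (0 / r) 0 := fun d => Maj.zero hr0 d (by simp)
    cases x with
    | e2_01 =>
      have h := (hS (field Γ0100)).solveU 1
      exact h.mono hr0 (by decide) (by simp only [fieldBound, e, add_zero]; exact le_rfl)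
    | e2_11 =>
      have h := (hS (field Γ1100)).solveU 0
      exact h.mono hr0 (by decide) (by simp only [fieldBound, e, add_zero]; exact le_rfl)
    | ζ0 =>
      refine ((hZ r hr S hS').integrateW_restrictU₀ hr0).mono hr0 (by decide) ?_
      have := le_abs_self Z
      simp only [e]
      gcongr
    | sHat =>
      refine ((hE r hr S hS').integrateW_restrictU₀ hr0).mono hr0 (by decide) ?_
      have := le_abs_self E
      simp only [e]
      gcongr
    | _ => exact h0 _
  exact (h1.add h2).mono hr0 (by simp) (by rw [← add_div])

/-- The quasilinear terms of the equations for the curvature are majorized by the `u`-derivative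
of the majorant, with a factor `1 / r` that comes from the frame coefficients. -/
theorem majDu_frame_terms (hr : 1 ≤ r)
    (hS : ∀ x, Maj r (weight x) (fieldBound A c r x) (S x)) (x y : GaugeField) (k : Fin 5)
    {d : ℤ} (hx : weight (field x) + 6 - (k : ℕ) ≤ d) (hy : weight (field y) + 3 - (k : ℕ) ≤ d) :
    MajDu r d ((512 * c x + 8192 * c y) * (((k : ℕ) + 1) * A) / r)
      (S (field x) * du (S (curv k)) + S (field y) * dv (S (curv k))) := by
  have hr0 : 0 < r := by linarith
  have hk : weight (curv k) = 4 - (k : ℕ) := rfl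
  have hb : 0 ≤ fieldBound A c r (curv k) := (hS _).nonneg
  have h1 := (hS (field x)).mul_majDu hr0 (hS (curv k)).du hb
  have h2 := (hS (field y)).mul_majDu hr0 ((hS (curv k)).dv hr (by rw [hk]; omega))
    (by positivity)
  refine (h1.add h2).mono hr0 ?_ (le_of_eq ?_)
  · rw [hk]
    exact max_le (by omega) (by omega)
  · simp only [fieldBound]
    ring

/-- The bounds `(k + 1) A` for `s_k` leave room for terms of order `1 / r` in the step from `s_k` to
`s_{k+1}` and, together with the rate `16 r` in `w`, in the transport equation for `s_0`. -/
theorem exists_curv_constant (A μ : ℝ) (hA : 0 < A) (c : GaugeField → ℝ) (hc : ∀ x, 0 < c x) :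
    ∃ r₁ : ℝ, ∀ (D : FormalSeries) (r : ℝ), 1 ≤ r → r₁ ≤ r → (∀ x, c x ≤ r) → Maj r 4 (A / 8) D →
      ∀ S : Unknown → FormalSeries, (∀ x, Maj r (weight x) (fieldBound A c r x) (S x)) →
        ∀ k : Fin 5, Maj r (weight (curv k)) (((k : ℕ) + 1) * A) (step μ D S (curv k)) := by
  obtain ⟨T, hT⟩ := tame_transportRhs A μ
  choose C hC using fun j => tame_curvRhs A μ j
  obtain ⟨K, hK⟩ := exists_forall_le C
  let K₀ : ℝ := (512 * c e1_11 + 8192 * c e2_11) * A + 4 * T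
  let K₁ : ℝ := (512 * c e1_01 + 8192 * c e2_01) * (4 * A) + 4 * K
  refine ⟨max (2 * K₀ / A) (K₁ / A), fun D r hr hr₁ hcr hD S hS k => ?_⟩
  have hr0 : 0 < r := by linarith
  have hS' := maj_size_of_maj_fieldBound hr0 hcr hS
  have hK₀ : K₀ / r ≤ A / 2 := by
    have := (div_le_iff₀ hA).1 ((le_max_left _ _).trans hr₁)
    rw [div_le_iff₀ hr0]
    linarith
  have hK₁ : K₁ / r ≤ A := by
    have := (div_le_iff₀ hA).1 ((le_max_right _ _).trans hr₁)
    rw [div_le_iff₀ hr0]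
    linarith
  induction k using Fin.cases with
  | zero =>
    -- The datum contributes `A / 8`, the term `∂_u s_2` contributes `3 A / 4`, all others `K₀ / (4 r)`.
    have h1 : MajDu r 4 (3 * A) (du (S (curv 2))) := by
      refine (hS (curv 2)).du.mono hr0 (by decide) (le_of_eq ?_)
      simp only [fieldBound]
      norm_num
    have h2 := (majDu_frame_terms hr hS e1_11 e2_11 0 (d := 4) (by decide) (by decide)).neg
    have h3 := (hT r hr S hS').majDu hr0
    have h4 := (h1.add h2).add h3
    have h5 := h4.integrateW hr0 (by
      have hT0 := (hT r hr S hS').nonneg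
      have := hc e1_11
      have := hc e2_11
      positivity)
    have h6 := (hD.add h5).mono (e := 4) (D := A) hr0 (by decide) (by
      simp only [Fin.val_zero, Nat.cast_zero, zero_add, one_mul]
      have e : 3 * A + (512 * c e1_11 + 8192 * c e2_11) * A / r + 4 * T / r = 3 * A + K₀ / r := by
        simp only [K₀]; ring
      rw [e]
      linarith)
    rw [step_curv_zero]
    have e : du (S (curv 2)) + -(S (field e1_11) * du (S (curv 0)))
      + -(S (field e2_11) * dv (S (curv 0))) + transportRhs μ S = du (S (curv 2)) +
        -(S (field e1_11) * du (S (curv 0)) + S (field e2_11) * dv (S (curv 0)))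
          + transportRhs μ S := by ring
    rw [e]
    exact h6.mono hr0 le_rfl (by simp)
  | succ j =>
    have hj : (0 : ℤ) < 4 - (j : ℕ) := by have := j.isLt; omega
    have hj' : (0 : ℝ) ≤ ((4 - (j : ℕ) : ℤ) : ℝ) / 2 := by
      have : (0 : ℝ) < ((4 - (j : ℕ) : ℤ) : ℝ) := by exact_mod_cast hj
      linarith
    have hw : weight (curv j.castSucc) = 4 - (j : ℕ) := rfl
    have hw' : weight (curv j.succ) = 4 - (j : ℕ) - 1 := by
      simp only [weight, Fin.val_succ]
      push_cast
      ring
    have h1 := (hS (curv j.castSucc)).solveU_half_dv hr0 (by rw [hw]; exact hj)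
    have h2 := majDu_frame_terms hr hS e1_01 e2_01 j.castSucc
      (d := weight (curv j.succ) + 2)
      (by rw [hw', show weight (field e1_01) = -1 from rfl, Fin.val_castSucc]; omega)
      (by rw [hw', show weight (field e2_01) = 2 from rfl, Fin.val_castSucc]; omega)
    have h3 := (hC j r hr S hS').majDu hr0
    have hC0 := (hC j r hr S hS').nonneg
    have h4 := (h2.add h3).solveU_u_mul hj' hr0 (by
      have := hc e1_01
      have := hc e2_01
      positivity)
    rw [step_curv_succ]
    rw [hw] at h1
    refine (h1.add h4).mono hr0 (by rw [hw', max_self]; exact max_le le_rfl (by omega)) ?_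
    have hjk : ((j : ℕ) : ℝ) + 1 ≤ 4 := by
      exact_mod_cast (by have := j.isLt; omega : (j : ℕ) + 1 ≤ 4)
    have h5 : (512 * c e1_01 + 8192 * c e2_01) * (((j.castSucc : ℕ) + 1) * A) / r + 4 * C j / r
        ≤ K₁ / r := by
      rw [← add_div]
      have h01 := hc e1_01
      have h02 := hc e2_01
      have := hK j
      simp only [K₁, Fin.val_castSucc]
      gcongr
    simp only [fieldBound, Fin.val_succ, Fin.val_castSucc] at h5 ⊢
    push_cast
    linarith

theorem exists_inv_constant (A μ : ℝ) :
    ∃ r₁ : ℝ, ∀ (D : FormalSeries) (r : ℝ), 1 ≤ r → r₁ ≤ r →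
      ∀ S : Unknown → FormalSeries, (∀ x, Maj r (weight x) (size A x) (S x)) →
        Maj r (weight inv) 2 (step μ D S inv) := by
  obtain ⟨Q, hQ⟩ : Tame A 2 (fun S => (μ : ℂ) • (S inv * S inv * S (field ζ0))) :=
    ((((Tame.atom _).mul (Tame.atom _)).mul (Tame.atom _)).smul _).mono (by decide)
  refine ⟨4 * Q, fun D r hr hr₁ S hS => ?_⟩
  have hr0 : 0 < r := by linarith
  rw [step_inv]
  have h := (hQ r hr S hS).solveU_u_mul (d := 0) (a := (0 : ℕ)) hr0 (by simp)
  refine ((Maj.one hr0).add h).mono hr0 (by decide) ?_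
  have : 4 * Q / r ≤ 1 := (div_le_one hr0).2 hr₁
  linarith

/-- For large `r`, the bounds `fieldBound` are preserved by `step`. The constants are chosen in this
order: those of the curvature first, then those of the fields, and then `r`. -/
theorem exists_preserved_bounds (A μ : ℝ) (hA : 0 < A) :
    ∃ c : GaugeField → ℝ, (∀ x, 0 < c x) ∧ ∃ r₁ : ℝ, ∀ r : ℝ, 1 ≤ r → r₁ ≤ r →
      ∀ D : FormalSeries, Maj r 4 (A / 8) D → ∀ S : Unknown → FormalSeries,
        (∀ x, Maj r (weight x) (fieldBound A c r x) (S x)) →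
          ∀ x, Maj r (weight x) (fieldBound A c r x) (step μ D S x) := by
  obtain ⟨c, hc, hfield⟩ := exists_field_constants A μ
  obtain ⟨r₁, hcurv⟩ := exists_curv_constant A μ hA c hc
  obtain ⟨r₂, hinv⟩ := exists_inv_constant A μ
  obtain ⟨K, hK⟩ := exists_forall_le c
  refine ⟨c, hc, max K (max r₁ r₂), fun r hr hr₁ D hD S hS x => ?_⟩
  have hcr : ∀ x, c x ≤ r := fun x => (hK x).trans ((le_max_left _ _).trans hr₁)
  have h1 : r₁ ≤ r := (le_max_left _ _).trans ((le_max_right _ _).trans hr₁)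
  have h2 : r₂ ≤ r := (le_max_right _ _).trans ((le_max_right _ _).trans hr₁)
  rcases x with x | k | _
  · exact hfield D r hr hcr S hS x
  · exact hcurv D r hr h1 hcr hD S hS k
  · exact hinv D r hr h2 S (maj_size_of_maj_fieldBound (by linarith) hcr hS)

end Preserved

end Unknown

/-! ### The degree of the datum -/

/-- The terms `u ^ m v ^ n` with `n > 2 m + 4` do not occur in the Taylor expansion of the datum. -/
theorem taylorDeriv_eq_zero {s₀ : ℂ × ℂ → ℂ} {ψ : ℕ → ℕ → ℂ}
    (hψ : ∀ᶠ z : ℂ × ℂ in 𝓝 (0, 0),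
      HasSum (fun m : ℕ => ∑ n ∈ Finset.range (2 * m + 5), ψ m n * z.1 ^ m * z.2 ^ n) (s₀ z))
    {m n : ℕ} (hn : 2 * m + 4 < n) : taylorDeriv m n s₀ = 0 := by
  rw [nhds_prod_eq, eventually_swap_iff] at hψ
  have h : (fun v : ℂ => iteratedDeriv m (fun u : ℂ => s₀ (u, v)) 0) =ᶠ[𝓝 0]
      fun v => ∑ k ∈ Finset.range (2 * m + 5), ((m ! : ℂ) * ψ m k) * v ^ k := by
    filter_upwards [hψ.curry] with v hv
    let p := FormalMultilinearSeries.ofScalars ℂ fun m : ℕ =>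
      ∑ k ∈ Finset.range (2 * m + 5), ψ m k * v ^ k
    have hp : HasFPowerSeriesAt (fun u : ℂ => s₀ (u, v)) p 0 := by
      rw [hasFPowerSeriesAt_iff]
      filter_upwards [hv] with u hu
      rw [zero_add]
      refine hu.congr_fun ?_
      intro k
      rw [FormalMultilinearSeries.coeff_ofScalars, smul_eq_mul, Finset.mul_sum]
      exact Finset.sum_congr rfl fun j _ => by simp only [Prod.swap]; ring
    obtain ⟨R, hR⟩ := hp
    have := hR.factorial_smul 1 m
    rw [iteratedDeriv_eq_iteratedFDeriv, ← this]
    change m ! • p.coeff m = _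
    rw [FormalMultilinearSeries.coeff_ofScalars, nsmul_eq_mul, Finset.mul_sum]
    exact Finset.sum_congr rfl fun j _ => by ring
  rw [taylorDeriv, h.iteratedDeriv_eq, iteratedDeriv_fun_sum fun i _ => by fun_prop]
  refine Finset.sum_eq_zero fun k hk => ?_
  have hk := Finset.mem_range.1 hk
  rw [iteratedDeriv_const_mul_field, iteratedDeriv_fun_pow_zero, if_neg (by omega),
    Nat.cast_zero, mul_zero]

/-! ### Estimates for derivatives, and convergence -/

namespace FormalSeries

theorem wgt_le_one (n : ℕ) : wgt n ≤ 1 := by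
  unfold wgt
  refine div_le_one_of_le₀ ?_ (by positivity)
  nlinarith [(Nat.cast_nonneg n : (0 : ℝ) ≤ n)]

theorem Maj.norm_derivAt_le {r C : ℝ} {d : ℤ} {f : FormalSeries} (hr : 0 < r) (hf : Maj r d C f)
    (m n p : ℕ) : ‖derivAt m n p f‖ ≤ C * ((16 * r) ^ (m + p) * ((m + p) ! : ℝ) * 1 ^ n * (n ! : ℝ)
      / ((m + 1 : ℝ) ^ 2 * (n + 1 : ℝ) ^ 2 * (p + 1 : ℝ) ^ 2)) := by
  have hC := hf.nonneg
  have h1 := wgt_pos m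
  have h2 := wgt_pos n
  have h3 := wgt_pos p
  have hfac : (((m + p).choose m : ℕ) : ℝ) * (m ! : ℝ) * (p ! : ℝ) = ((m + p) ! : ℝ) := by
    rw [Nat.choose_symm_add]
    exact_mod_cast Nat.add_choose_mul_factorial_mul_factorial m p
  rw [derivAt, norm_mul, norm_mul, norm_mul, Complex.norm_natCast, Complex.norm_natCast,
    Complex.norm_natCast]
  calc (m ! : ℝ) * (n ! : ℝ) * (p ! : ℝ) * ‖coeffAt m n p f‖
      ≤ (m ! : ℝ) * (n ! : ℝ) * (p ! : ℝ) * (C * majorant r m n p) := by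
        gcongr
        exact hf.bound m n p
    _ = C * (r ^ m * (16 * r) ^ p * ((((m + p).choose m : ℕ) : ℝ) * (m ! : ℝ) * (p ! : ℝ)) *
          (n ! : ℝ) * (wgt m * wgt n * wgt p)) := by
        unfold majorant; ring
    _ ≤ C * ((16 * r) ^ m * (16 * r) ^ p * ((((m + p).choose m : ℕ) : ℝ) * (m ! : ℝ) * (p ! : ℝ)) *
          (n ! : ℝ) * (wgt m * wgt n * wgt p)) := by
        gcongr
        linarith
    _ = _ := by
        rw [hfac]
        unfold wgt
        rw [pow_add, one_pow]
        field_simp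

/-- The binomial series in two variables. -/
theorem summable_choose_mul_pow_mul_pow {x y : ℝ} (hx : 0 ≤ x) (hy : 0 ≤ y) (hxy : x + y < 1) :
    Summable fun i : ℕ × ℕ => ((i.1 + i.2).choose i.1 : ℝ) * x ^ i.1 * y ^ i.2 := by
  have hy1 : ‖y‖ < 1 := by rw [Real.norm_of_nonneg hy]; linarith
  have hy2 : 0 < 1 - y := by linarith
  have h := fun k : ℕ => (hasSum_choose_mul_geometric_of_norm_lt_one k hy1).mul_left (x ^ k)
  have e : ∀ k : ℕ, (fun n : ℕ => x ^ k * (((n + k).choose k : ℝ) * y ^ n)) =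
      fun n : ℕ => ((k + n).choose k : ℝ) * x ^ k * y ^ n := fun k => by
    funext n
    rw [add_comm n k]
    ring
  refine (summable_prod_of_nonneg fun i => by dsimp; positivity).2 ⟨fun k => ?_, ?_⟩
  · rw [← e k]
    exact (h k).summable
  · have h' : ∀ k : ℕ, ∑' n : ℕ, ((k + n).choose k : ℝ) * x ^ k * y ^ n =
        1 / (1 - y) * (x / (1 - y)) ^ k := fun k => by
      rw [← e k, (h k).tsum_eq, div_pow, pow_succ]
      field_simp
    simp only [h']
    refine (summable_geometric_of_lt_one (by positivity) ?_).mul_left _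
    rw [div_lt_one hy2]
    linarith

theorem Maj.absConvergesAt {r C : ℝ} {d : ℤ} {f : FormalSeries} (hr : 0 < r) (hf : Maj r d C f)
    {u v w : ℂ} (huw : ‖u‖ + ‖w‖ < 1 / (16 * r)) (hv : ‖v‖ < 1) : AbsConvergesAt f u v w := by
  have hC := hf.nonneg
  have huw' : 16 * r * ‖u‖ + 16 * r * ‖w‖ < 1 := by
    rw [lt_div_iff₀ (by positivity)] at huw
    linarith
  have h1 := summable_choose_mul_pow_mul_pow (x := 16 * r * ‖u‖) (y := 16 * r * ‖w‖)
    (by positivity) (by positivity) huw'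
  have h2 := summable_geometric_of_lt_one (norm_nonneg v) hv
  have h3 := (h1.mul_of_nonneg h2 (fun i => by dsimp; positivity)
    (fun i => by dsimp; positivity)).mul_left C
  have h4 := h3.comp_injective (i := fun i : ℕ × ℕ × ℕ => ((i.1, i.2.2), i.2.1)) (by
    rintro ⟨a, b, c⟩ ⟨a', b', c'⟩ h
    simp only [Prod.mk.injEq] at h ⊢
    tauto)
  refine Summable.of_nonneg_of_le (fun i => norm_nonneg _) (fun i => ?_) h4
  obtain ⟨m, n, p⟩ := i
  have hw : wgt m * wgt n * wgt p ≤ 1 :=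
    mul_le_one₀ (mul_le_one₀ (wgt_le_one m) (wgt_pos n).le (wgt_le_one n)) (wgt_pos p).le
      (wgt_le_one p)
  simp only [Function.comp, norm_mul, norm_pow]
  calc ‖coeffAt m n p f‖ * ‖u‖ ^ m * ‖v‖ ^ n * ‖w‖ ^ p
      ≤ (C * majorant r m n p) * ‖u‖ ^ m * ‖v‖ ^ n * ‖w‖ ^ p := by
        gcongr
        exact hf.bound m n p
    _ ≤ (C * (((m + p).choose m : ℝ) * (16 * r) ^ m * (16 * r) ^ p * 1)) *
          ‖u‖ ^ m * ‖v‖ ^ n * ‖w‖ ^ p := by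
        unfold majorant
        have h1 := (wgt_pos m).le
        have h2 := (wgt_pos n).le
        have h3 := (wgt_pos p).le
        gcongr
        linarith
    _ = _ := by
        rw [mul_pow (16 * r), mul_pow (16 * r)]
        ring

end FormalSeries

namespace Unknown

open FormalSeries

theorem maj_datum {s₀ : ℂ × ℂ → ℂ} {ψ : ℕ → ℕ → ℂ}
    (hψ : ∀ᶠ z : ℂ × ℂ in 𝓝 (0, 0),
      HasSum (fun m : ℕ => ∑ n ∈ Finset.range (2 * m + 5), ψ m n * z.1 ^ m * z.2 ^ n) (s₀ z))
    {c₀ r₀ ρ₀ r : ℝ} (hc₀ : 0 < c₀) (hr₀ : 0 < r₀) (hρ₀ : 0 < ρ₀) (hρ₀' : ρ₀ < 1 / 2)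
    (hest : ∀ m n : ℕ, n ≤ 2 * m + 4 →
      ‖taylorDeriv m n s₀‖
        ≤ c₀ * ((m ! : ℝ) * (n ! : ℝ) * r₀ ^ m * ρ₀ ^ n / ((1 + m : ℝ) ^ 2 * (1 + n : ℝ) ^ 2)))
    (hr : r₀ ≤ r) : Maj r 4 c₀ (datum s₀) := by
  have hr0 : 0 < r := by linarith
  have hdeg : ∀ m n : ℕ, 2 * (m : ℤ) + 4 < n → taylorDeriv m n s₀ = 0 := fun m n h =>
    taylorDeriv_eq_zero hψ (by omega)
  refine ⟨fun m n p h => by simp [datum, hdeg m n h], fun m n p => ?_⟩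
  have hM := majorant_nonneg hr0 m n p
  rw [datum, coeffAt_ofCoeffs]
  split_ifs with hp
  · subst hp
    rw [norm_div, norm_mul, Complex.norm_natCast, Complex.norm_natCast]
    rcases le_or_gt n (2 * m + 4) with h | h
    · have hm : (0 : ℝ) < (m ! : ℝ) := by exact_mod_cast m.factorial_pos
      have hn : (0 : ℝ) < (n ! : ℝ) := by exact_mod_cast n.factorial_pos
      have h1 := wgt_pos m
      have h2 := wgt_pos n
      rw [div_le_iff₀ (by positivity)]
      refine (hest m n h).trans ?_
      calc c₀ * ((m ! : ℝ) * (n ! : ℝ) * r₀ ^ m * ρ₀ ^ n / ((1 + m : ℝ) ^ 2 * (1 + n : ℝ) ^ 2))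
          = c₀ * (r₀ ^ m * ρ₀ ^ n * (wgt m * wgt n)) * ((m ! : ℝ) * (n ! : ℝ)) := by
            unfold wgt
            rw [add_comm (1 : ℝ) m, add_comm (1 : ℝ) n]
            field_simp
        _ ≤ c₀ * (r ^ m * 1 * (wgt m * wgt n)) * ((m ! : ℝ) * (n ! : ℝ)) := by
            have := pow_le_one₀ (n := n) hρ₀.le (by linarith)
            gcongr
        _ = _ := by simp [majorant, wgt_zero]
    · rw [taylorDeriv_eq_zero hψ h, norm_zero, zero_div]
      positivity
  · rw [norm_zero]
    positivity

end Unknown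

end

theorem mainTheorem5 (μ : ℝ) (hμ : 0 < μ)
    (U : Set (ℂ × ℂ)) (hU : IsOpen U) (hOU : ((0, 0) : ℂ × ℂ) ∈ U)
    (s₀ : ℂ × ℂ → ℂ) (hs₀ : DifferentiableOn ℂ s₀ U)
    (ψ : ℕ → ℕ → ℂ)
    (hψ : ∀ᶠ z : ℂ × ℂ in 𝓝 (0, 0),
      HasSum (fun m : ℕ => ∑ n ∈ Finset.range (2 * m + 5), ψ m n * z.1 ^ m * z.2 ^ n) (s₀ z))
    (c₀ r₀ ρ₀ : ℝ) (hc₀ : 0 < c₀) (hr₀ : 0 < r₀) (hρ₀ : 0 < ρ₀) (hρ₀' : ρ₀ < 1 / 2)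
    (hest : ∀ m n : ℕ, n ≤ 2 * m + 4 →
      ‖taylorDeriv m n s₀‖
        ≤ c₀ * ((m ! : ℝ) * (n ! : ℝ) * r₀ ^ m * ρ₀ ^ n / ((1 + m : ℝ) ^ 2 * (1 + n : ℝ) ^ 2))) :
    ∃ F : FormalFields,
      (F.IsFormalSolution μ s₀ ∧ ∀ G : FormalFields, G.IsFormalSolution μ s₀ → G = F) ∧
      ∃ (r ρ : ℝ) (c : GaugeField → ℝ) (cs : Fin 5 → ℝ),
        r₀ ≤ r ∧ 0 < ρ ∧ (∀ x, 0 < c x) ∧ (∀ k, 0 < cs k) ∧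
        (∀ (k : Fin 5) (m n p : ℕ),
          ‖FormalSeries.derivAt m n p (F.s k)‖
            ≤ cs k * (r ^ (m + p) * ((m + p) ! : ℝ) * ρ ^ n * (n ! : ℝ)
              / ((m + 1 : ℝ) ^ 2 * (n + 1 : ℝ) ^ 2 * (p + 1 : ℝ) ^ 2))) ∧
        (∀ (x : GaugeField) (m n p : ℕ),
          ‖FormalSeries.derivAt m n p (F.f x)‖
            ≤ c x * (r ^ ((m : ℤ) + p - 1) * ((m + p) ! : ℝ) * ρ ^ n * (n ! : ℝ)
              / ((m + 1 : ℝ) ^ 2 * (n + 1 : ℝ) ^ 2 * (p + 1 : ℝ) ^ 2))) ∧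
        ∀ u v w : ℂ, ‖u‖ + ‖w‖ < 1 / r → ‖v‖ < 1 / ρ →
          (∀ k, (F.s k).AbsConvergesAt u v w) ∧ ∀ x, (F.f x).AbsConvergesAt u v w := by
  obtain ⟨S, hS, hsol, huniq⟩ := Unknown.exists_unique_isFormalSolution μ s₀
  -- The datum, which is bounded by `c₀`, may use one eighth of the bound for `s_0`.
  obtain ⟨c, hc, r₁, hpres⟩ := Unknown.exists_preserved_bounds (8 * c₀) μ (by positivity)
  obtain ⟨r, hr1, hr₁, hrr⟩ : ∃ r : ℝ, 1 ≤ r ∧ r₁ ≤ r ∧ r₀ ≤ r :=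
    ⟨max 1 (max r₁ r₀), le_max_left _ _, (le_max_left _ _).trans (le_max_right _ _),
      (le_max_right _ _).trans (le_max_right _ _)⟩
  have hr0 : 0 < r := by linarith
  have hD : FormalSeries.Maj r 4 (8 * c₀ / 8) (Unknown.datum s₀) := by
    rw [mul_div_cancel_left₀ _ (by norm_num)]
    exact Unknown.maj_datum hψ hc₀ hr₀ hρ₀ hρ₀' hest hrr
  have hB : ∀ x, FormalSeries.Maj r (Unknown.weight x) (Unknown.fieldBound (8 * c₀) c r x) (S x) :=
    Unknown.bound_of_step_eq μ (Unknown.datum s₀) r hr0 Unknown.weight _ (fun x => by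
      rcases x with x | k | _
      · exact (div_pos (hc x) hr0).le
      · simp only [Unknown.fieldBound]; positivity
      · exact zero_le_two) (hpres r hr1 hr₁ _ hD) hS
  refine ⟨Unknown.toFields S, ⟨hsol, huniq⟩, 16 * r, 1, fun x => 16 * c x, fun k => ((k : ℕ) + 1) * (8 * c₀),
    by linarith, one_pos, fun x => mul_pos (by norm_num) (hc x), fun k => by positivity,
    fun k m n p => (hB (.curv k)).norm_derivAt_le hr0 m n p, fun x m n p => ?_,
    fun u v w huw hv => ⟨fun k => (hB (.curv k)).absConvergesAt hr0 huw (by simpa using hv),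
      fun x => (hB (.field x)).absConvergesAt hr0 huw (by simpa using hv)⟩⟩
  -- `c x / r = 16 * c x / (16 * r)`
  refine ((hB (.field x)).norm_derivAt_le hr0 m n p).trans (le_of_eq ?_)
  rw [zpow_sub_one₀ (by positivity), show (m : ℤ) + p = ((m + p : ℕ) : ℤ) by push_cast; rfl,
    zpow_natCast]
  simp only [Unknown.fieldBound]
  field_simp
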